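/- Let $\mu>0$, $T>0$, $\Omega=\mathbb R$, $\Omega_-=\,]-\infty,0[$, $\Omega_+=\,]0,\infty[$. Write $\mathcal L_{SV}W=0$ for the linear Saint-Venant system $\partial_t\eta+\partial_xu=0$, $\partial_tu+\partial_x\eta=0$, and $\mathcal L_BW=0$ for the linear Boussinesq system $\partial_t\eta+\partial_xu=0$, $\partial_tu-\mu^2\partial_t\partial_x^2u+\partial_x\eta=0$, where $W=(\eta,u)$. Let $W_0=(\eta_0,u_0)\in (C^1(\mathbb R)\cap L^2(\mathbb R))^2$ vanish outside $\Omega_-$. Let $(W_-,W_+)$ be a classical solution of the Saint-Venant-to-Boussinesq hybrid problem: $\mathcal L_{SV}W_-=0$ in $\overline\Omega_-\times[0,T]$, $\mathcal L_BW_+=0$ in $\overline\Omega_+\times[0,T]$ with $W_+\in L^2(\Omega_+\times]0,T[)^2$, $W_\pm(\cdot,0)=W_0$, and $u_-(0,t)=u_+(0,t)$, $\partial_xu_-(0,t)=\partial_xu_+(0,t)$ for $0\le t\le T$. (Here all derivatives occurring in the equations exist and are continuous up to the boundary: $W_-$, $\eta_+$, $u_+$, $\partial_xu_+$, $\partial_x^2u_+$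 are $C^1$ there.) Let $W_{c}$ be the classical solution of $\mathcal L_{SV}W_c=0$ in $\mathbb R\times[0,T]$ with $W_c(\cdot,0)=W_0$, and put $W_-'=W_--W_c$ on $\overline\Omega_-\times[0,T]$. Let $\lambda_-(s)=s$, $\lambda_+(s)=s/\sqrt{1+\mu^2s^2}$ (principal root) and $r=(\lambda_--\lambda_+)/(\lambda_-+\lambda_+)$ be the reflection coefficient, $\omega_-(\kappa)=\kappa$ the Saint-Venant dispersion relation, $R f(x)=f(-x)$, $G=\mathrm{diag}(-1,1)$, and, for a function $\rho$ of the angular wave number $\kappa$, let $\mathcal F^{-1}(\rho)*f$ be the function with Fourier transform $\rho\,\mathcal F(f)$ ($L^2$ Fourier transform). 1. The limit $r(j\omega):=\lim_{\sigma\to0^+}r(\sigma+j\omega)$ exists for every $\omega\in\mathbb R$. For $|\omega|<1/\mu$ it is the value of $r$ at $j\omega$ given by the formula above (read as $0$ at $\omega=0$). With this $r(j\omega)$, $W_-'$ is the restriction to $\overline\Omega_-\times[0,T]$ of a classical solution $W$ of the Cauchy problem $$\mathcal L_{SV}W=0\ \text{ in }\mathbb R\times[0,T],\qquad W(\cdot,0)=\mathcal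 F^{-1}\bigl(r(j\omega_-)\bigr)*GRW_0\ \text{ in }\mathbb R .$$ 2. In particular, if $\mathcal F(W_0)$ vanishes almost everywhere outside $]-1/\mu,1/\mu[$, the same holds with $r(j\omega_-(\kappa))$ given directly by the formula for $r$ at $s=j\omega_-(\kappa)$. -/

import Mathlib

open Set MeasureTheory Filter Topology
open scoped FourierTransform

noncomputable section

/-- Partial derivative in time of `f (x, t)`, for times in `[0, T]`
(one-sided at the end points). -/
def dTime (T : ℝ) (f : ℝ → ℝ → ℝ) (x t : ℝ) : ℝ :=
  derivWithin (fun τ => f x τ) (Icc 0 T) t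

/-- Partial derivative in space of `f (x, t)`, for positions in the interval `X`
(one-sided at the end points). -/
def dSpace (X : Set ℝ) (f : ℝ → ℝ → ℝ) (x t : ℝ) : ℝ :=
  derivWithin (fun y => f y t) X x

/-- `f` is of class `C¹` on `X × [0, T]`, up to the boundary. -/
def IsC1On (X : Set ℝ) (T : ℝ) (f : ℝ → ℝ → ℝ) : Prop :=
  ContDiffOn ℝ 1 (Function.uncurry f) (X ×ˢ Icc 0 T)

/-- `W = (η, u)` is a (classical) solution on `X × [0, T]` of the linear Saint-Venant system
`∂ₜ η + ∂ₓ u = 0`, `∂ₜ u + ∂ₓ η = 0` with initial datum `(η₀, u₀)` on `X`. -/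
structure IsSaintVenantSolution (X : Set ℝ) (T : ℝ) (η₀ u₀ : ℝ → ℝ) (η u : ℝ → ℝ → ℝ) :
    Prop where
  smooth_eta : IsC1On X T η
  smooth_u : IsC1On X T u
  mass : ∀ x ∈ X, ∀ t ∈ Icc 0 T, dTime T η x t + dSpace X u x t = 0
  momentum : ∀ x ∈ X, ∀ t ∈ Icc 0 T, dTime T u x t + dSpace X η x t = 0
  initial_eta : ∀ x ∈ X, η x 0 = η₀ x
  initial_u : ∀ x ∈ X, u x 0 = u₀ x

/-- `W = (η, u)` is a (classical) solution on `X × [0, T]` of the linear Boussinesq system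
`∂ₜ η + ∂ₓ u = 0`, `∂ₜ u - μ² ∂ₜ ∂ₓ² u + ∂ₓ η = 0` with initial datum `(η₀, u₀)` on `X`. The system
has no finite speed of propagation, so decay at infinity is imposed: `W ∈ L²(X × ]0, T[)`. -/
structure IsBoussinesqSolution (μ : ℝ) (X : Set ℝ) (T : ℝ) (η₀ u₀ : ℝ → ℝ)
    (η u : ℝ → ℝ → ℝ) : Prop where
  smooth_eta : IsC1On X T η
  smooth_u : IsC1On X T u
  smooth_ux : IsC1On X T (dSpace X u)
  smooth_uxx : IsC1On X T (dSpace X (dSpace X u))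
  mass : ∀ x ∈ X, ∀ t ∈ Icc 0 T, dTime T η x t + dSpace X u x t = 0
  momentum : ∀ x ∈ X, ∀ t ∈ Icc 0 T,
    dTime T u x t - μ ^ 2 * dTime T (dSpace X (dSpace X u)) x t + dSpace X η x t = 0
  initial_eta : ∀ x ∈ X, η x 0 = η₀ x
  initial_u : ∀ x ∈ X, u x 0 = u₀ x
  memLp_eta : MemLp (Function.uncurry η) 2 (volume.restrict (X ×ˢ Ioo 0 T))
  memLp_u : MemLp (Function.uncurry u) 2 (volume.restrict (X ×ˢ Ioo 0 T))

/-- The Saint-Venant-to-Boussinesq hybrid problem with datum `(η₀, u₀)`: `(ηm, um)` solves the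
Saint-Venant system on `x ≤ 0`, `(ηp, up)` solves the Boussinesq system on `x ≥ 0`, and the two are
coupled by the continuity of `u` and of `∂ₓ u` through the interface `x = 0`. -/
structure IsHybridSVBSolution (μ T : ℝ) (η₀ u₀ : ℝ → ℝ) (ηm um ηp up : ℝ → ℝ → ℝ) : Prop where
  left : IsSaintVenantSolution (Iic 0) T η₀ u₀ ηm um
  right : IsBoussinesqSolution μ (Ici 0) T η₀ u₀ ηp up
  coupling_u : ∀ t ∈ Icc 0 T, um 0 t = up 0 t
  coupling_ux : ∀ t ∈ Icc 0 T, dSpace (Iic 0) um 0 t = dSpace (Ici 0) up 0 t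

/-- The eigenvalue `s / √(1 + μ² s²)` (principal root) of the half-line problem in the Laplace
domain, for the Boussinesq (`μ > 0`) and the Saint-Venant (`μ = 0`) operators. -/
def halfLineEigenvalue (μ : ℝ) (s : ℂ) : ℂ :=
  s / (1 + (μ : ℂ) ^ 2 * s ^ 2) ^ (1 / 2 : ℂ)

/-- The reflection coefficient `r = (λ₋ - λ₊) / (λ₋ + λ₊)`, with `λ₋` the Saint-Venant and `λ₊` the
Boussinesq eigenvalue. -/
def reflectionCoeff (μ : ℝ) (s : ℂ) : ℂ :=
  (halfLineEigenvalue 0 s - halfLineEigenvalue μ s) /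
    (halfLineEigenvalue 0 s + halfLineEigenvalue μ s)

/-- The dispersion relation `ω(κ) = κ / √(1 + μ² κ²)` (for `μ = 0`, the Saint-Venant one). -/
def dispersion (μ κ : ℝ) : ℝ := κ / √(1 + μ ^ 2 * κ ^ 2)

/-- The `L²` Fourier transform of `f` vanishes (a.e.) at the angular wave numbers
`κ = 2πξ` outside `]-K, K[`. -/
def HasSpectrumIn (K : ℝ) (f : ℝ → ℝ) : Prop :=
  ∃ hf : MemLp (fun x => (f x : ℂ)) 2 (volume : Measure ℝ),
    ∀ᵐ ξ : ℝ, 2 * Real.pi * ξ ∉ Ioo (-K) K → (𝓕 hf.toLp : Lp ℂ 2 (volume : Measure ℝ)) ξ = 0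

/-- `g = 𝓕⁻¹(ρ) * f`, that is, `g` and `f` are square integrable and `𝓕 g (κ) = ρ(κ) 𝓕 f (κ)` for
almost every angular wave number `κ = 2πξ`. -/
def IsFilteredBy (ρ : ℝ → ℂ) (f g : ℝ → ℝ) : Prop :=
  ∃ (hf : MemLp (fun x => (f x : ℂ)) 2 (volume : Measure ℝ))
    (hg : MemLp (fun x => (g x : ℂ)) 2 (volume : Measure ℝ)),
    ∀ᵐ ξ : ℝ, (𝓕 hg.toLp : Lp ℂ 2 (volume : Measure ℝ)) ξ =
      ρ (2 * Real.pi * ξ) * (𝓕 hf.toLp : Lp ℂ 2 (volume : Measure ℝ)) ξ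

/-- On `x ≤ 0`, `0 ≤ t ≤ T`, the pair `(η', u')` is the restriction of the solution on the whole
line of the Saint-Venant system with initial datum `𝓕⁻¹(ρ) * G R W₀`, where `W₀ = (η₀, u₀)`,
`R f (x) = f (-x)` and `G = diag(-1, 1)`. -/
def IsFilteredReflection (ρ : ℝ → ℂ) (T : ℝ) (η₀ u₀ : ℝ → ℝ) (η' u' : ℝ → ℝ → ℝ) : Prop :=
  ∃ (ζ₀ v₀ : ℝ → ℝ) (ζ v : ℝ → ℝ → ℝ),
    IsFilteredBy ρ (fun x => -η₀ (-x)) ζ₀ ∧ IsFilteredBy ρ (fun x => u₀ (-x)) v₀ ∧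
    IsSaintVenantSolution univ T ζ₀ v₀ ζ v ∧
    ∀ x ≤ 0, ∀ t ∈ Icc 0 T, η' x t = ζ x t ∧ u' x t = v x t

end

/-! Everything is reduced to an operator equation in time at the interface. Let J be integration
from 0 on C([0, T]), with symbol 1/s. Since ‖Jⁿ‖ ≤ Tⁿ/n!, the power series of L = (μ² + J²)^(-1/2)
converges (`invSqrtOp`), and B = J L has symbol S = 1/√(1 + μ²s²). It is convolution with a Bessel
kernel (`primOp_mul_invSqrtOp_apply`).

On the right, zero data turn the Boussinesq system into U'' = L² U for the curve x ↦ u(x, ·). The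
operators exp(-xL) decay because L is 1/μ plus a quasinilpotent part, and square integrability
excludes the growing mode. Hence ∂ₓu = -L u at x = 0 (`deriv_eq_neg_invSqrtOp`), and conservation of
mass with the coupling conditions gives η₋ = B u₋ there. On the left, characteristics bring η₋ + u₋
= 2a to the interface, with a known from the datum. So (1 + B) u₋ = 2a, that is u₋ = a + R a with R
= (1 - B)/(1 + B) (`eq_add_reflect`), and the outgoing invariant η₋ - u₋ at the interface is -2 R a.
D'Alembert's formula then produces the wave on the whole line.

It remains to see R as a Fourier multiplier. In the Laplace domain R multiplies by (1 - S)/(1 + S) =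
r(s) for Re s > 0 (`laplace_reflect`). The Bessel kernel is of positive type, which selects the
principal root and makes R a contraction of L² (`integral_reflect_sq_le`). For functions vanishing
on the negative axis, the Fourier integral damped by exp(-σ|x|) is the Laplace transform at σ + jω,
and σ → 0⁺ gives the multiplier r(jω) (`isFilteredBy_reflect`). When the spectrum lies in ]-1/μ,
1/μ[, only values of r given by the formula are used. -/

noncomputable section

/-! ### The L² Fourier transform as a limit of damped Fourier integrals. -/

/-- On `L¹ ∩ L²` the `L²` Fourier transform is given by the Fourier integral. -/
theorem fourier_toLp_ae_eq {f : ℝ → ℂ} (hf : Integrable f) (h2 : MemLp f 2 volume) :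
    (𝓕 h2.toLp : Lp ℂ 2 (volume : Measure ℝ)) =ᵐ[volume] 𝓕 f := by
  have hc : Continuous (𝓕 f) :=
    VectorFourier.fourierIntegral_continuous Real.continuous_fourierChar
      (by exact continuous_inner) hf
  refine ae_eq_of_integral_contDiff_smul_eq
    ((Lp.memLp _).locallyIntegrable (by norm_num)) hc.locallyIntegrable ?_
  intro g hg hgc
  have hgC : ContDiff ℝ ((⊤ : ℕ∞) : WithTop ℕ∞) (fun x => (g x : ℂ)) := by
    exact Complex.ofRealCLM.contDiff.comp hg
  have hgs : HasCompactSupport (fun x => (g x : ℂ)) := hgc.comp_left (g := fun y : ℝ => (y : ℂ)) (by simp)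
  -- Both functions define the same tempered distribution: tested against φ, each Fourier transform
  -- can be moved onto φ.
  let φ : SchwartzMap ℝ ℂ := hgs.toSchwartzMap hgC
  have h := Lp.fourier_toTemperedDistribution_eq (E := ℝ) (F := ℂ) h2.toLp
  have h' := DFunLike.congr_fun h φ
  rw [TemperedDistribution.fourier_apply, Lp.toTemperedDistribution_apply,
    Lp.toTemperedDistribution_apply] at h'
  have e1 : ∫ x, (𝓕 φ) x • (h2.toLp : Lp ℂ 2 (volume : Measure ℝ)) x = ∫ x, (𝓕 φ) x • f x := by
    refine integral_congr_ae ?_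
    filter_upwards [h2.coeFn_toLp] with x hx
    rw [hx]
  have e2 : ∫ x, (𝓕 φ) x • f x = ∫ x, φ x • 𝓕 f x := by
    have := VectorFourier.integral_fourierIntegral_smul_eq_flip (L := innerₗ ℝ)
      (f := φ) (g := f) Real.continuous_fourierChar continuous_inner (φ.integrable (μ := volume)) hf
    simpa using! this
  rw [e1, e2] at h'
  simpa [φ, eq_comm] using h'

/-- The function `f` damped by `exp (-σ |x|)`. -/
def damp (σ : ℝ) (f : ℝ → ℂ) (x : ℝ) : ℂ := (Real.exp (-σ * |x|) : ℂ) * f x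

theorem integrable_exp_neg_mul_abs {σ : ℝ} (hσ : 0 < σ) :
    Integrable (fun x : ℝ => Real.exp (-σ * |x|)) := by
  have h1 : IntegrableOn (fun x : ℝ => Real.exp (-σ * |x|)) (Ioi 0) := by
    refine (integrableOn_exp_mul_Ioi (a := -σ) (by linarith) 0).congr_fun ?_ measurableSet_Ioi
    intro x hx
    simp [abs_of_pos (mem_Ioi.1 hx)]
  have h2 : IntegrableOn (fun x : ℝ => Real.exp (-σ * |x|)) (Iic 0) := by
    refine (integrableOn_exp_mul_Iic hσ 0).congr_fun ?_ measurableSet_Iic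
    intro x hx
    simp [abs_of_nonpos (mem_Iic.1 hx)]
  rw [← integrableOn_univ, ← Iic_union_Ioi (a := (0 : ℝ))]
  exact h2.union h1

theorem norm_damp_le {σ : ℝ} (hσ : 0 < σ) (f : ℝ → ℂ) (x : ℝ) : ‖damp σ f x‖ ≤ ‖f x‖ := by
  rw [damp, norm_mul, Complex.norm_real, Real.norm_eq_abs, Real.abs_exp]
  refine mul_le_of_le_one_left (norm_nonneg _) (Real.exp_le_one_iff.2 ?_)
  nlinarith [abs_nonneg x]

theorem memLp_damp {σ : ℝ} (hσ : 0 < σ) {f : ℝ → ℂ} (hf : MemLp f 2 volume) :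
    MemLp (damp σ f) 2 volume := by
  refine hf.mono ?_ (ae_of_all _ (norm_damp_le hσ f))
  exact (Continuous.aestronglyMeasurable (by fun_prop)).mul hf.1

theorem integrable_damp {σ : ℝ} (hσ : 0 < σ) {f : ℝ → ℂ} (hf : MemLp f 2 volume) :
    Integrable (damp σ f) := by
  have h : MemLp (fun x : ℝ => (Real.exp (-σ * |x|) : ℂ)) 2 volume := by
    rw [memLp_two_iff_integrable_sq_norm (Continuous.aestronglyMeasurable (by fun_prop))]
    refine (integrable_exp_neg_mul_abs (σ := 2 * σ) (by linarith)).congr (ae_of_all _ fun x => ?_)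
    simp only [Complex.norm_real, Real.norm_eq_abs, Real.abs_exp]
    rw [← Real.exp_nat_mul]
    congr 1
    push_cast
    ring
  exact h.integrable_mul hf

theorem tendsto_damp_toLp {f : ℝ → ℂ} (hf : MemLp f 2 volume) {σ : ℕ → ℝ}
    (hσ : ∀ n, 0 < σ n) (hl : Tendsto σ atTop (𝓝 0)) :
    Tendsto (fun n => (memLp_damp (hσ n) hf).toLp) atTop (𝓝 hf.toLp) := by
  refine (Lp.tendsto_Lp_iff_tendsto_eLpNorm'' _ (fun n => memLp_damp (hσ n) hf) _ hf).2 ?_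
  simp_rw [eLpNorm_eq_lintegral_rpow_enorm_toReal (μ := (volume : Measure ℝ)) (p := 2) (by norm_num) (by norm_num)]
  have key : Tendsto (fun n => ∫⁻ x, ‖(damp (σ n) f - f) x‖ₑ ^ (2 : ENNReal).toReal) atTop
      (𝓝 (∫⁻ _ : ℝ, 0)) := by
    refine tendsto_lintegral_of_dominated_convergence' (fun x => ‖f x‖ₑ ^ (2 : ENNReal).toReal)
      (fun n => ?_) (fun n => ae_of_all _ fun x => ?_) ?_ (ae_of_all _ fun x => ?_)
    · exact (((memLp_damp (hσ n) hf).1.sub hf.1).enorm).pow_const _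
    · refine ENNReal.rpow_le_rpow ?_ (by norm_num)
      rw [enorm_le_iff_norm_le]
      have : (damp (σ n) f - f) x = ((Real.exp (-σ n * |x|) - 1 : ℝ) : ℂ) * f x := by
        simp [damp]; ring
      rw [this, norm_mul, Complex.norm_real, Real.norm_eq_abs]
      refine mul_le_of_le_one_left (norm_nonneg _) ?_
      have h1 : Real.exp (-σ n * |x|) ≤ 1 :=
        Real.exp_le_one_iff.2 (by nlinarith [abs_nonneg x, hσ n])
      have h2 := Real.exp_pos (-σ n * |x|)
      rw [abs_le]; constructor <;> linarith
    · exact (lintegral_rpow_enorm_lt_top_of_eLpNorm_lt_top (by norm_num) (by norm_num) hf.2).ne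
    · have : Tendsto (fun n => (damp (σ n) f - f) x) atTop (𝓝 0) := by
        have h1 : Tendsto (fun n => ((Real.exp (-σ n * |x|) : ℝ) : ℂ) * f x - f x) atTop
            (𝓝 (((Real.exp (-0 * |x|) : ℝ) : ℂ) * f x - f x)) := by
          refine Tendsto.sub_const (Tendsto.mul_const _ ?_) _
          refine (Complex.continuous_ofReal.tendsto _).comp ?_
          exact (Real.continuous_exp.tendsto _).comp (hl.neg.mul_const _)
        simpa [damp] using h1
      have h2 := ((ENNReal.continuous_rpow_const (y := (2 : ENNReal).toReal)).tendsto _).comp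
        ((continuous_enorm.tendsto _).comp this)
      simpa using! h2
  have h3 := ((ENNReal.continuous_rpow_const (y := 1 / (2 : ENNReal).toReal)).tendsto _).comp key
  simpa using! h3

/-- The `L²` Fourier transform is an almost everywhere limit of Fourier integrals of the damped
functions, along a subsequence. -/
theorem exists_subseq_fourier_damp {f : ℝ → ℂ} (hf : MemLp f 2 volume) {σ : ℕ → ℝ}
    (hσ : ∀ n, 0 < σ n) (hl : Tendsto σ atTop (𝓝 0)) :
    ∃ ns : ℕ → ℕ, StrictMono ns ∧ ∀ᵐ ξ : ℝ, Tendsto (fun n => 𝓕 (damp (σ (ns n)) f) ξ) atTop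
      (𝓝 ((𝓕 hf.toLp : Lp ℂ 2 (volume : Measure ℝ)) ξ)) := by
  have h1 : Tendsto (fun n => (𝓕 (memLp_damp (hσ n) hf).toLp : Lp ℂ 2 (volume : Measure ℝ))) atTop
      (𝓝 (𝓕 hf.toLp)) :=
    ((FourierTransform.fourierCLM ℂ (Lp ℂ 2 (volume : Measure ℝ))).continuous.tendsto _).comp
      (tendsto_damp_toLp hf hσ hl)
  obtain ⟨ns, hns, hae⟩ := (tendstoInMeasure_of_tendsto_Lp h1).exists_seq_tendsto_ae
  refine ⟨ns, hns, ?_⟩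
  have h2 : ∀ᵐ ξ : ℝ, ∀ n, (𝓕 (memLp_damp (hσ n) hf).toLp : Lp ℂ 2 (volume : Measure ℝ)) ξ =
      𝓕 (damp (σ n) f) ξ :=
    ae_all_iff.2 fun n => fourier_toLp_ae_eq (integrable_damp (hσ n) hf) _
  filter_upwards [hae, h2] with ξ hξ h2ξ
  exact hξ.congr fun n => h2ξ _

/-- Two square integrable functions have a common sequence of damping parameters along which the
Fourier integrals converge almost everywhere to the `L²` Fourier transforms. -/
theorem exists_seq_fourier_damp₂ {f g : ℝ → ℂ} (hf : MemLp f 2 volume) (hg : MemLp g 2 volume) :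
    ∃ σ : ℕ → ℝ, (∀ n, 0 < σ n) ∧ Tendsto σ atTop (𝓝 0) ∧
      (∀ᵐ ξ : ℝ, Tendsto (fun n => 𝓕 (damp (σ n) f) ξ) atTop
        (𝓝 ((𝓕 hf.toLp : Lp ℂ 2 (volume : Measure ℝ)) ξ))) ∧
      ∀ᵐ ξ : ℝ, Tendsto (fun n => 𝓕 (damp (σ n) g) ξ) atTop
        (𝓝 ((𝓕 hg.toLp : Lp ℂ 2 (volume : Measure ℝ)) ξ)) := by
  let σ : ℕ → ℝ := fun n => 1 / ((n : ℝ) + 1)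
  have hσ : ∀ n, 0 < σ n := fun n => by positivity
  have hl : Tendsto σ atTop (𝓝 0) := tendsto_one_div_add_atTop_nhds_zero_nat
  obtain ⟨ns, hns, h1⟩ := exists_subseq_fourier_damp hf hσ hl
  obtain ⟨ms, hms, h2⟩ := exists_subseq_fourier_damp hg (σ := fun n => σ (ns n))
    (fun n => hσ _) (hl.comp hns.tendsto_atTop)
  refine ⟨fun n => σ (ns (ms n)), fun n => hσ _,
    hl.comp (hns.tendsto_atTop.comp hms.tendsto_atTop), ?_, h2⟩
  filter_upwards [h1] with ξ hξ
  exact hξ.comp hms.tendsto_atTop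

theorem fourier_comp_neg (f : ℝ → ℂ) (ξ : ℝ) : 𝓕 (fun x => f (-x)) ξ = 𝓕 f (-ξ) := by
  rw [Real.fourier_real_eq, Real.fourier_real_eq, ← integral_neg_eq_self]
  simp

/-- The `L²` Fourier transform commutes with the reflection `x ↦ -x`. -/
theorem fourier_toLp_comp_neg {f : ℝ → ℂ} (hf : MemLp f 2 volume)
    (hf' : MemLp (fun x => f (-x)) 2 volume) :
    ∀ᵐ ξ : ℝ, (𝓕 hf'.toLp : Lp ℂ 2 (volume : Measure ℝ)) ξ =
      (𝓕 hf.toLp : Lp ℂ 2 (volume : Measure ℝ)) (-ξ) := by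
  obtain ⟨σ, -, -, h1, h2⟩ := exists_seq_fourier_damp₂ hf hf'
  have h1' := (Measure.measurePreserving_neg (volume : Measure ℝ)).quasiMeasurePreserving.ae h1
  filter_upwards [h1', h2] with ξ a b
  refine tendsto_nhds_unique b (a.congr fun n => ?_)
  rw [← fourier_comp_neg]
  refine congrFun (congrArg _ (funext fun x => ?_)) ξ
  simp [damp]

/-! ### Power series for the inverse square root in a Banach algebra. -/

/-- The Taylor coefficients of `(1 - y) ^ (-1 / 2)`. -/
def invSqrtCoeff (k : ℕ) : ℝ := ∏ i ∈ Finset.range k, (2 * (i : ℝ) + 1) / (2 * i + 2)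

theorem invSqrtCoeff_zero : invSqrtCoeff 0 = 1 := by simp [invSqrtCoeff]

theorem succ_mul_invSqrtCoeff_succ (k : ℕ) :
    ((k : ℝ) + 1) * invSqrtCoeff (k + 1) = (k + 1 / 2) * invSqrtCoeff k := by
  rw [invSqrtCoeff, Finset.prod_range_succ, ← invSqrtCoeff]
  field_simp

theorem invSqrtCoeff_nonneg (k : ℕ) : 0 ≤ invSqrtCoeff k :=
  Finset.prod_nonneg fun i _ => by positivity

theorem invSqrtCoeff_le_one (k : ℕ) : invSqrtCoeff k ≤ 1 := by
  refine Finset.prod_le_one (fun i _ => by positivity) fun i _ => ?_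
  rw [div_le_one (by positivity)]
  linarith

theorem norm_invSqrtCoeff_le_one (k : ℕ) : ‖invSqrtCoeff k‖ ≤ 1 := by
  rw [Real.norm_of_nonneg (invSqrtCoeff_nonneg k)]
  exact invSqrtCoeff_le_one k

/-- The square of (1 - y)^(-1/2) is the geometric series. With Cₙ the sum, the recurrence for the
coefficients and the symmetry of the antidiagonal give (n + 1) Cₙ₊₁ = n Cₙ + Cₙ. -/
theorem sum_antidiagonal_invSqrtCoeff (n : ℕ) :
    ∑ p ∈ Finset.HasAntidiagonal.antidiagonal n, invSqrtCoeff p.1 * invSqrtCoeff p.2 = 1 := by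
  have sym : ∀ n : ℕ, 2 * ∑ p ∈ Finset.HasAntidiagonal.antidiagonal n,
      (p.1 : ℝ) * (invSqrtCoeff p.1 * invSqrtCoeff p.2) =
      n * ∑ p ∈ Finset.HasAntidiagonal.antidiagonal n, invSqrtCoeff p.1 * invSqrtCoeff p.2 := by
    intro n
    have h : ∑ p ∈ Finset.HasAntidiagonal.antidiagonal n, (p.1 : ℝ) * (invSqrtCoeff p.1 * invSqrtCoeff p.2) =
        ∑ p ∈ Finset.HasAntidiagonal.antidiagonal n, (p.2 : ℝ) * (invSqrtCoeff p.1 * invSqrtCoeff p.2) := by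
      rw [← Finset.Nat.sum_antidiagonal_swap]
      exact Finset.sum_congr rfl fun p _ => by simp [mul_comm]
    rw [two_mul]
    nth_rw 2 [h]
    rw [← Finset.sum_add_distrib, Finset.mul_sum]
    refine Finset.sum_congr rfl fun p hp => ?_
    rw [← Finset.HasAntidiagonal.mem_antidiagonal.1 hp]
    push_cast
    ring
  induction n with
  | zero => simp [invSqrtCoeff_zero]
  | succ n ih =>
    have h1 := sym (n + 1)
    have h0 := sym n
    rw [Finset.Nat.sum_antidiagonal_succ] at h1
    have h2 : ∑ p ∈ Finset.HasAntidiagonal.antidiagonal n,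
        (((p.1 + 1 : ℕ) : ℝ)) * (invSqrtCoeff (p.1 + 1) * invSqrtCoeff p.2) =
        ∑ p ∈ Finset.HasAntidiagonal.antidiagonal n, (p.1 : ℝ) * (invSqrtCoeff p.1 * invSqrtCoeff p.2) +
        1 / 2 * ∑ p ∈ Finset.HasAntidiagonal.antidiagonal n, invSqrtCoeff p.1 * invSqrtCoeff p.2 := by
      rw [Finset.mul_sum, ← Finset.sum_add_distrib]
      refine Finset.sum_congr rfl fun p _ => ?_
      have := succ_mul_invSqrtCoeff_succ p.1
      push_cast
      linear_combination invSqrtCoeff p.2 * this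
    simp only [h2, ih] at h1 h0
    push_cast at h1
    have hn : (n : ℝ) + 1 ≠ 0 := by positivity
    apply mul_left_cancel₀ hn
    linear_combination -h1 + h0

section BanachAlgebra

variable {A : Type*} [NormedRing A] [NormedAlgebra ℝ A]

/-- `(1 - y) ^ (-1 / 2)` in a Banach algebra, for `y` with summable powers. -/
def invSqrtOneSub (y : A) : A := ∑' k, invSqrtCoeff k • y ^ k

theorem summable_norm_invSqrtCoeff_smul {y : A} (hy : Summable fun k => ‖y ^ k‖) :
    Summable fun k => ‖invSqrtCoeff k • y ^ k‖ := by
  refine hy.of_nonneg_of_le (fun _ => norm_nonneg _) fun k => ?_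
  rw [norm_smul]
  exact mul_le_of_le_one_left (norm_nonneg _) (norm_invSqrtCoeff_le_one k)

theorem invSqrtOneSub_mul_self_mul [CompleteSpace A] {y : A} (hy : Summable fun k => ‖y ^ k‖) :
    invSqrtOneSub y * invSqrtOneSub y * (1 - y) = 1 := by
  have hs := summable_norm_invSqrtCoeff_smul hy
  have h1 : invSqrtOneSub y * invSqrtOneSub y = ∑' n, y ^ n := by
    rw [invSqrtOneSub, tsum_mul_tsum_eq_tsum_sum_antidiagonal_of_summable_norm hs hs]
    refine tsum_congr fun n => ?_
    calc _ = ∑ p ∈ Finset.HasAntidiagonal.antidiagonal n, (invSqrtCoeff p.1 * invSqrtCoeff p.2) • y ^ n := by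
          refine Finset.sum_congr rfl fun p hp => ?_
          rw [smul_mul_smul_comm, ← pow_add, Finset.HasAntidiagonal.mem_antidiagonal.1 hp]
      _ = y ^ n := by rw [← Finset.sum_smul, sum_antidiagonal_invSqrtCoeff, one_smul]
  have hs' : Summable fun n => y ^ n := hy.of_norm
  rw [h1, mul_sub, mul_one, ← hs'.tsum_mul_right]
  simp_rw [← pow_succ]
  rw [hs'.tsum_eq_zero_add]
  simp


theorem commute_invSqrtOneSub {x y : A} (h : Commute x y) : Commute x (invSqrtOneSub y) :=
  Commute.tsum_right _ fun k => (h.pow_right k).smul_right _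

theorem invSqrtOneSub_eq_one_add [CompleteSpace A] {y : A} (hy : Summable fun k => ‖y ^ k‖) :
    invSqrtOneSub y = 1 + y * ∑' k, invSqrtCoeff (k + 1) • y ^ k := by
  have hs : Summable fun k => invSqrtCoeff k • y ^ k :=
    (summable_norm_invSqrtCoeff_smul hy).of_norm
  have hs' : Summable fun k => invSqrtCoeff (k + 1) • y ^ k := by
    refine Summable.of_norm (hy.of_nonneg_of_le (fun _ => norm_nonneg _) fun k => ?_)
    rw [norm_smul]
    exact mul_le_of_le_one_left (norm_nonneg _) (norm_invSqrtCoeff_le_one _)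
  rw [invSqrtOneSub, hs.tsum_eq_zero_add, ← hs'.tsum_mul_left]
  simp [invSqrtCoeff_zero, pow_succ']

theorem exp_mul_exp_neg [CompleteSpace A] (x : A) :
    NormedSpace.exp x * NormedSpace.exp (-x) = 1 := by
  let _ : NormedAlgebra ℚ A := NormedAlgebra.restrictScalars ℚ ℝ A
  rw [← NormedSpace.exp_add_of_commute (Commute.neg_right (Commute.refl x)), add_neg_cancel,
    NormedSpace.exp_zero]

/-- If the powers of `J` are bounded by `c ^ n / n!`, then `exp (x J M)` grows more slowly than
any exponential. -/
theorem norm_exp_smul_mul_le [CompleteSpace A] {J M : A} {c : ℝ}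
    (hJ : ∀ n, ‖J ^ n‖ ≤ c ^ n / n.factorial) (hM : ∀ n, ‖M ^ n‖ ≤ ‖M‖ ^ n)
    (hc : 0 ≤ c) (hJM : Commute J M) {ε x : ℝ} (hε : 0 < ε) (hx : 0 ≤ x) :
    ‖NormedSpace.exp (-x • (J * M))‖ ≤ Real.exp (ε * x) * Real.exp (c * ‖M‖ / ε) := by
  have h := NormedSpace.exp_series_hasSum_exp' (𝕂 := ℝ) (-x • (J * M))
  have hr : HasSum (fun n : ℕ => Real.exp (ε * x) * ((c * ‖M‖ / ε) ^ n / n.factorial))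
      (Real.exp (ε * x) * Real.exp (c * ‖M‖ / ε)) := by
    refine HasSum.mul_left _ ?_
    rw [Real.exp_eq_exp_ℝ]
    exact NormedSpace.expSeries_div_hasSum_exp _
  rw [← h.tsum_eq]
  refine tsum_of_norm_bounded hr fun n => ?_
  rw [smul_pow, hJM.mul_pow, norm_smul, norm_smul, norm_inv, norm_pow, norm_neg,
    Real.norm_of_nonneg hx, RCLike.norm_natCast]
  have h1 : ‖J ^ n * M ^ n‖ ≤ c ^ n / n.factorial * ‖M‖ ^ n :=
    (norm_mul_le _ _).trans (mul_le_mul (hJ n) (hM n) (norm_nonneg _) (by positivity))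
  have h2 : (ε * x) ^ n / n.factorial ≤ Real.exp (ε * x) :=
    Real.pow_div_factorial_le_exp _ (by positivity) n
  -- There are two factorials, one from the exponential series and one from `hJ`. Inserting εⁿ ε⁻ⁿ
  -- between them leaves one factor below exp(εx) and a summable one free of x.
  calc (n.factorial : ℝ)⁻¹ * (x ^ n * ‖J ^ n * M ^ n‖)
      ≤ (n.factorial : ℝ)⁻¹ * (x ^ n * (c ^ n / n.factorial * ‖M‖ ^ n)) := by gcongr
    _ = (ε * x) ^ n / n.factorial * ((c * ‖M‖ / ε) ^ n / n.factorial) := by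
        rw [mul_pow, div_pow, mul_pow]
        field_simp
    _ ≤ _ := by gcongr

/-- `(μ² + J²) ^ (-1 / 2)`. -/
def invSqrtOp (μ : ℝ) (J : A) : A := μ⁻¹ • invSqrtOneSub (-(μ⁻¹ ^ 2) • J ^ 2)

variable {J : A} {c : ℝ}

theorem summable_norm_pow_smul_sq (hJ : ∀ n, ‖J ^ n‖ ≤ c ^ n / n.factorial) (a : ℝ) :
    Summable fun k => ‖(a • J ^ 2) ^ k‖ := by
  have hs : Summable fun k : ℕ => (|a| * c ^ 2) ^ k / k.factorial :=
    Real.summable_pow_div_factorial _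
  refine hs.of_nonneg_of_le (fun _ => norm_nonneg _) fun k => ?_
  rw [smul_pow, ← pow_mul, norm_smul, norm_pow, Real.norm_eq_abs, mul_pow, mul_div_assoc]
  refine mul_le_mul_of_nonneg_left ((hJ _).trans ?_) (by positivity)
  rw [pow_mul]
  gcongr
  omega

theorem commute_invSqrtOp (μ : ℝ) : Commute J (invSqrtOp μ J) :=
  (commute_invSqrtOneSub (((Commute.refl J).pow_right 2).smul_right _)).smul_right _

variable [CompleteSpace A]

theorem hasSum_mul_invSqrtOp (μ : ℝ) (hJ : ∀ n, ‖J ^ n‖ ≤ c ^ n / n.factorial) :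
    HasSum (fun k : ℕ => (μ⁻¹ * (-(μ⁻¹ ^ 2)) ^ k * invSqrtCoeff k) • J ^ (2 * k + 1))
      (J * invSqrtOp μ J) := by
  have hs := (summable_norm_invSqrtCoeff_smul (summable_norm_pow_smul_sq hJ
    (-(μ⁻¹ ^ 2)))).of_norm.hasSum
  refine ((hs.const_smul μ⁻¹).mul_left J).congr_fun fun k => ?_
  rw [smul_pow, ← pow_mul, smul_smul, smul_smul, mul_smul_comm, ← pow_succ']
  congr 1
  ring

theorem invSqrtOp_mul_self_mul {μ : ℝ} (hμ : 0 < μ)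
    (hJ : ∀ n, ‖J ^ n‖ ≤ c ^ n / n.factorial) :
    invSqrtOp μ J * invSqrtOp μ J * (μ ^ 2 • (1 : A) + J ^ 2) = 1 := by
  have h := invSqrtOneSub_mul_self_mul (summable_norm_pow_smul_sq hJ (-(μ⁻¹ ^ 2)))
  have e : μ ^ 2 • (1 : A) + J ^ 2 = μ ^ 2 • (1 - (-(μ⁻¹ ^ 2) • J ^ 2)) := by
    rw [smul_sub, smul_smul]
    have : μ ^ 2 * -(μ⁻¹ ^ 2) = -1 := by field_simp
    rw [this]
    simp
  rw [e, invSqrtOp, smul_mul_smul_comm, smul_mul_smul_comm, h]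
  have : μ⁻¹ * μ⁻¹ * μ ^ 2 = 1 := by field_simp
  rw [this, one_smul]

/-- The constant term of the power series is 1/μ and every other term contains a factor J. This
isolates the scalar responsible for the decay of exp(-xL). -/
theorem exists_invSqrtOp_eq (μ : ℝ) (hJ : ∀ n, ‖J ^ n‖ ≤ c ^ n / n.factorial) :
    ∃ M : A, Commute J M ∧ invSqrtOp μ J = μ⁻¹ • 1 + J * M := by
  set y : A := -(μ⁻¹ ^ 2) • J ^ 2 with hy
  have h := invSqrtOneSub_eq_one_add (summable_norm_pow_smul_sq hJ (-(μ⁻¹ ^ 2)))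
  rw [← hy] at h
  set G : A := ∑' k, invSqrtCoeff (k + 1) • y ^ k with hG
  have hJy : Commute J y := ((Commute.refl J).pow_right 2).smul_right _
  have hJG : Commute J G := Commute.tsum_right _ fun k => (hJy.pow_right k).smul_right _
  refine ⟨(μ⁻¹ * -(μ⁻¹ ^ 2)) • (J * G), ((Commute.refl J).mul_right hJG).smul_right _, ?_⟩
  rw [invSqrtOp, ← hy, h, smul_add, hy, smul_mul_assoc, smul_smul, mul_smul_comm, pow_two J,
    mul_assoc J]

/-- The scalar part contributes exp(-x/μ), and the remaining factor grows more slowly than any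
exponential. Taking ε = 1/(2μ) gives up half of the decay rate. -/
theorem exists_norm_exp_neg_smul_invSqrtOp_le {μ : ℝ} (hμ : 0 < μ)
    (hJ : ∀ n, ‖J ^ n‖ ≤ c ^ n / n.factorial) (hc : 0 ≤ c) (h1 : ‖(1 : A)‖ ≤ 1) :
    ∃ C : ℝ, ∀ x : ℝ, 0 ≤ x →
      ‖NormedSpace.exp (-x • invSqrtOp μ J)‖ ≤ C * Real.exp (-(x / (2 * μ))) := by
  obtain ⟨M, hJM, hM⟩ := exists_invSqrtOp_eq μ hJ
  refine ⟨Real.exp (c * ‖M‖ / (1 / (2 * μ))), fun x hx => ?_⟩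
  let _ : NormedAlgebra ℚ A := NormedAlgebra.restrictScalars ℚ ℝ A
  -- The case n = 0 is the bound ‖1‖ ≤ 1, which a general normed ring need not satisfy.
  have hpow : ∀ n, ‖M ^ n‖ ≤ ‖M‖ ^ n := fun n => by
    rcases Nat.eq_zero_or_pos n with rfl | hn
    · simpa using h1
    · exact norm_pow_le' M hn
  have e : -x • invSqrtOp μ J = algebraMap ℝ A (-(x / μ)) + -x • (J * M) := by
    rw [hM, smul_add, Algebra.algebraMap_eq_smul_one, smul_smul]
    congr 2
    field_simp
  have hcomm : Commute (algebraMap ℝ A (-(x / μ))) (-x • (J * M)) := Algebra.commutes _ _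
  rw [e, NormedSpace.exp_add_of_commute hcomm, ← NormedSpace.algebraMap_exp_comm,
    Algebra.algebraMap_eq_smul_one, smul_mul_assoc, one_mul, norm_smul, ← Real.exp_eq_exp_ℝ,
    Real.norm_eq_abs, Real.abs_exp]
  have h2 := norm_exp_smul_mul_le hJ hpow hc hJM (ε := 1 / (2 * μ)) (by positivity) hx
  calc _ ≤ Real.exp (-(x / μ)) *
        (Real.exp (1 / (2 * μ) * x) * Real.exp (c * ‖M‖ / (1 / (2 * μ)))) := by gcongr
    _ = _ := by
        rw [← mul_assoc, ← Real.exp_add, mul_comm]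
        congr 2
        field_simp
        ring

end BanachAlgebra

/-! ### Integration in time as an operator on C([0, T]). -/

/-- One integration by parts; this is the induction step of Cauchy's formula for repeated
integration, `primOp_pow_succ_apply`. -/
theorem integral_sub_pow_mul_eq {f : ℝ → ℝ} (hf : Continuous f) (n : ℕ) (t : ℝ) :
    ∫ s in (0 : ℝ)..t, (t - s) ^ (n + 1) / (n + 1).factorial * f s =
      ∫ s in (0 : ℝ)..t, (t - s) ^ n / n.factorial * ∫ r in (0 : ℝ)..s, f r := by
  have hu : ∀ s ∈ uIcc 0 t, HasDerivAt (fun s : ℝ => (t - s) ^ (n + 1) / ((n + 1).factorial : ℝ))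
      (-((t - s) ^ n / n.factorial)) s := by
    intro s _
    have h := ((((hasDerivAt_id s).const_sub t).pow (n + 1)).div_const ((n + 1).factorial : ℝ))
    convert! h using 1
    simp only [Nat.factorial_succ, Nat.cast_mul, Nat.add_sub_cancel, id]
    have : (n.factorial : ℝ) ≠ 0 := by positivity
    field_simp
  have hv : ∀ s ∈ uIcc 0 t, HasDerivAt (fun s : ℝ => ∫ r in (0 : ℝ)..s, f r) (f s) s :=
    fun s _ => hf.integral_hasStrictDerivAt 0 s |>.hasDerivAt
  rw [intervalIntegral.integral_mul_deriv_eq_deriv_mul hu hv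
    (Continuous.intervalIntegrable (by fun_prop) _ _) (hf.intervalIntegrable _ _)]
  simp

/-- The function `t ↦ ∫₀ᵗ k (t - s) f (s) ds`. -/
def volterra (k f : ℝ → ℝ) (t : ℝ) : ℝ := ∫ s in (0 : ℝ)..t, k (t - s) * f s

/-- The primitive of `f` vanishing at `0`. -/
def primitive (f : ℝ → ℝ) (t : ℝ) : ℝ := ∫ s in (0 : ℝ)..t, f s

theorem continuous_primitive {f : ℝ → ℝ} (hf : Continuous f) : Continuous (primitive f) :=
  intervalIntegral.continuous_primitive (fun _ _ => hf.intervalIntegrable _ _) _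

theorem continuous_volterra {k f : ℝ → ℝ} (hk : Continuous k) (hf : Continuous f) :
    Continuous (volterra k f) := by
  refine intervalIntegral.continuous_parametric_intervalIntegral_of_continuous
    (f := fun t s => k (t - s) * f s) ?_ continuous_id
  simp only [Function.uncurry_def]
  fun_prop

theorem primitive_congr {f g : ℝ → ℝ} {T t : ℝ} (h : ∀ s ∈ Icc 0 T, f s = g s)
    (ht : t ∈ Icc 0 T) : primitive f t = primitive g t := by
  refine intervalIntegral.integral_congr fun s hs => h s ?_
  rw [uIcc_of_le ht.1] at hs
  exact ⟨hs.1, hs.2.trans ht.2⟩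

theorem volterra_congr {k f g : ℝ → ℝ} {T t : ℝ} (h : ∀ s ∈ Icc 0 T, f s = g s)
    (ht : t ∈ Icc 0 T) : volterra k f t = volterra k g t := by
  refine intervalIntegral.integral_congr fun s hs => ?_
  rw [uIcc_of_le ht.1] at hs
  simp only [h s ⟨hs.1, hs.2.trans ht.2⟩]

section Operators

variable {T : ℝ} (hT : 0 ≤ T)

/-- Integration in time, as an operator on `C([0, T])`. -/
def primOp : C(Icc (0 : ℝ) T, ℝ) →L[ℝ] C(Icc (0 : ℝ) T, ℝ) :=
  LinearMap.mkContinuous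
    { toFun := fun f => ⟨fun t => primitive (IccExtend hT f) t,
        (continuous_primitive f.continuous.Icc_extend').comp continuous_subtype_val⟩
      map_add' := fun f g => by
        ext t
        exact intervalIntegral.integral_add (f.continuous.Icc_extend'.intervalIntegrable _ _)
          (g.continuous.Icc_extend'.intervalIntegrable _ _)
      map_smul' := fun c f => by
        ext t
        exact intervalIntegral.integral_smul c _ }
    T fun f => by
      refine (ContinuousMap.norm_le _ (by positivity)).2 fun t => ?_
      have h : ∀ s ∈ uIoc (0 : ℝ) t, ‖IccExtend hT f s‖ ≤ ‖f‖ := fun s _ =>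
        f.norm_coe_le_norm _
      refine (intervalIntegral.norm_integral_le_of_norm_le_const h).trans ?_
      rw [sub_zero, abs_of_nonneg t.2.1, mul_comm]
      gcongr
      exact t.2.2

theorem primOp_apply (f : C(Icc (0 : ℝ) T, ℝ)) (t : Icc (0 : ℝ) T) :
    primOp hT f t = primitive (IccExtend hT f) t := rfl

theorem primOp_pow_succ_apply (n : ℕ) (f : C(Icc (0 : ℝ) T, ℝ)) (t : Icc (0 : ℝ) T) :
    (primOp hT ^ (n + 1)) f t =
      ∫ s in (0 : ℝ)..t, ((t : ℝ) - s) ^ n / n.factorial * IccExtend hT f s := by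
  induction n generalizing f with
  | zero => simp [primOp_apply, primitive]
  | succ n ih =>
    rw [pow_succ, mul_apply_eq_comp, ih,
      integral_sub_pow_mul_eq f.continuous.Icc_extend']
    refine intervalIntegral.integral_congr fun s hs => ?_
    rw [uIcc_of_le t.2.1] at hs
    rw [IccExtend_of_mem hT _ ⟨hs.1, hs.2.trans t.2.2⟩, primOp_apply]
    rfl

theorem norm_primOp_pow_le (n : ℕ) : ‖primOp hT ^ n‖ ≤ T ^ n / n.factorial := by
  rcases n with _ | n
  · simpa using! (ContinuousLinearMap.norm_id_le : ‖ContinuousLinearMap.id ℝ C(Icc (0 : ℝ) T, ℝ)‖ ≤ 1)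
  refine ContinuousLinearMap.opNorm_le_bound _ (by positivity) fun f => ?_
  refine (ContinuousMap.norm_le _ (by positivity)).2 fun t => ?_
  rw [primOp_pow_succ_apply]
  have h : ∀ s ∈ Ioc (0 : ℝ) t, ‖((t : ℝ) - s) ^ n / n.factorial * IccExtend hT f s‖ ≤
      ((t : ℝ) - s) ^ n / n.factorial * ‖f‖ := by
    intro s hs
    have h0 : 0 ≤ (t : ℝ) - s := sub_nonneg.2 hs.2
    rw [norm_mul, Real.norm_of_nonneg (by positivity)]
    gcongr
    exact f.norm_coe_le_norm _
  refine (intervalIntegral.norm_integral_le_of_norm_le t.2.1 (ae_of_all _ fun s hs => h s hs)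
    (Continuous.intervalIntegrable (by fun_prop) _ _)).trans ?_
  have e : ∫ s in (0 : ℝ)..t, ((t : ℝ) - s) ^ n / n.factorial * ‖f‖ =
      (t : ℝ) ^ (n + 1) / (n + 1).factorial * ‖f‖ := by
    rw [intervalIntegral.integral_mul_const, intervalIntegral.integral_div,
      intervalIntegral.integral_comp_sub_left (fun s => s ^ n), integral_pow]
    simp only [Nat.factorial_succ]
    push_cast
    field_simp
    simp [mul_comm]
  rw [e]
  have := t.2.1
  gcongr
  exact t.2.2

end Operators

/-! ### The Bessel kernel and its convolution operator. -/

/-- The kernel `J₀ (t / μ) / μ` of the convolution operator with symbol `1 / √(1 + μ² s²)`. -/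
def besselKernel (μ t : ℝ) : ℝ :=
  (Real.pi * μ)⁻¹ * ∫ θ in (0 : ℝ)..Real.pi, Real.cos (t / μ * Real.sin θ)

theorem continuous_besselKernel (μ : ℝ) : Continuous (besselKernel μ) := by
  refine continuous_const.mul
    (intervalIntegral.continuous_parametric_intervalIntegral_of_continuous' ?_ _ _)
  simp only [Function.uncurry_def]
  fun_prop

theorem abs_besselKernel_le {μ : ℝ} (hμ : 0 < μ) (t : ℝ) : |besselKernel μ t| ≤ μ⁻¹ := by
  have h : ∀ θ ∈ uIoc (0 : ℝ) Real.pi, ‖Real.cos (t / μ * Real.sin θ)‖ ≤ 1 :=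
    fun θ _ => Real.abs_cos_le_one _
  have h2 := intervalIntegral.norm_integral_le_of_norm_le_const h
  rw [sub_zero, abs_of_pos Real.pi_pos, one_mul] at h2
  rw [besselKernel, abs_mul, abs_of_pos (by positivity)]
  calc _ ≤ (Real.pi * μ)⁻¹ * Real.pi := by gcongr; exact h2
    _ = μ⁻¹ := by field_simp

/-- The cosine series is integrated term by term; Wallis' integral of sin^(2k) over [0, π] is π
times `invSqrtCoeff k`. -/
theorem hasSum_besselKernel (μ t : ℝ) :
    HasSum (fun k : ℕ => μ⁻¹ * (-(μ⁻¹ ^ 2)) ^ k * invSqrtCoeff k * (t ^ (2 * k) / (2 * k).factorial))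
      (besselKernel μ t) := by
  have h : HasSum (fun k : ℕ => ∫ θ in (0 : ℝ)..Real.pi,
      (-1) ^ k * (t / μ * Real.sin θ) ^ (2 * k) / ((2 * k).factorial : ℝ))
      (∫ θ in (0 : ℝ)..Real.pi, Real.cos (t / μ * Real.sin θ)) := by
    refine intervalIntegral.hasSum_integral_of_dominated_convergence
      (fun k _ => |t / μ| ^ (2 * k) / (2 * k).factorial)
      (fun k => Continuous.aestronglyMeasurable (by fun_prop))
      (fun k => ae_of_all _ fun θ _ => ?_) (ae_of_all _ fun θ _ => ?_)
      intervalIntegrable_const (ae_of_all _ fun θ _ => Real.hasSum_cos _)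
    · rw [norm_div, norm_mul, norm_pow, norm_pow, norm_neg, norm_one, one_pow, one_mul,
        RCLike.norm_natCast, norm_mul, Real.norm_eq_abs, Real.norm_eq_abs]
      gcongr
      exact mul_le_of_le_one_right (abs_nonneg _) (Real.abs_sin_le_one _)
    · exact (Real.summable_pow_div_factorial |t / μ|).comp_injective
        (mul_right_injective₀ two_ne_zero)
  refine HasSum.congr_fun (h.mul_left (Real.pi * μ)⁻¹) fun k => ?_
  have e : ∫ θ in (0 : ℝ)..Real.pi,
      (-1) ^ k * (t / μ * Real.sin θ) ^ (2 * k) / ((2 * k).factorial : ℝ) =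
      (-1) ^ k * (t / μ) ^ (2 * k) / ((2 * k).factorial : ℝ) * (Real.pi * invSqrtCoeff k) := by
    rw [invSqrtCoeff, ← integral_sin_pow_even, ← intervalIntegral.integral_const_mul]
    refine intervalIntegral.integral_congr fun θ _ => ?_
    simp only [mul_pow]
    ring
  rw [e, neg_pow, mul_inv, div_pow, inv_pow, inv_pow, ← pow_mul, div_eq_mul_inv (t ^ (2 * k)) (μ ^ (2 * k))]
  have := Real.pi_ne_zero
  field_simp

/-- J^(2k+1) is convolution with t^(2k)/(2k)!, so the power series of J L in J becomes the power
series of the kernel. -/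
theorem primOp_mul_invSqrtOp_apply {μ T : ℝ} (hμ : 0 < μ) (hT : 0 ≤ T) (f : C(Icc (0 : ℝ) T, ℝ))
    (t : Icc (0 : ℝ) T) :
    (primOp hT * invSqrtOp μ (primOp hT)) f t =
      volterra (besselKernel μ) (IccExtend hT f) t := by
  set J := primOp hT with hJ
  set a : ℕ → ℝ := fun k => μ⁻¹ * (-(μ⁻¹ ^ 2)) ^ k * invSqrtCoeff k with ha
  have h1 : HasSum (fun k => a k • J ^ (2 * k + 1)) (J * invSqrtOp μ J) :=
    hasSum_mul_invSqrtOp (J := J) μ (norm_primOp_pow_le hT)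
  have h2 : HasSum (fun k => a k * ∫ s in (0 : ℝ)..t,
      ((t : ℝ) - s) ^ (2 * k) / (2 * k).factorial * IccExtend hT f s)
      ((J * invSqrtOp μ J) f t) := by
    have h := h1.mapL (((ContinuousMap.evalCLM ℝ t).comp
      (ContinuousLinearMap.apply ℝ C(Icc (0 : ℝ) T, ℝ) f)))
    refine h.congr_fun fun k => ?_
    rw [← primOp_pow_succ_apply hT]
    rfl
  have h3 : HasSum (fun k => ∫ s in (0 : ℝ)..t,
      a k * (((t : ℝ) - s) ^ (2 * k) / (2 * k).factorial) * IccExtend hT f s)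
      (volterra (besselKernel μ) (IccExtend hT f) t) := by
    have hc := f.continuous.Icc_extend' (h := hT)
    refine intervalIntegral.hasSum_integral_of_dominated_convergence
      (fun k _ => μ⁻¹ * ((T / μ) ^ (2 * k) / (2 * k).factorial) * ‖f‖)
      (fun k => Continuous.aestronglyMeasurable (by fun_prop))
      (fun k => ae_of_all _ fun s hs => ?_) (ae_of_all _ fun s _ => ?_)
      intervalIntegrable_const (ae_of_all _ fun s _ => (hasSum_besselKernel μ _).mul_right _)
    · rw [uIoc_of_le t.2.1] at hs
      have hts : |(t : ℝ) - s| ≤ T := by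
        rw [abs_of_nonneg (sub_nonneg.2 hs.2)]
        linarith [hs.1, t.2.2]
      rw [norm_mul, norm_mul, norm_div, norm_pow, RCLike.norm_natCast, Real.norm_eq_abs (_ - _)]
      have hak : ‖a k‖ ≤ μ⁻¹ * (μ⁻¹ ^ 2) ^ k := by
        simp only [ha]
        rw [norm_mul, norm_mul, norm_pow, norm_neg, Real.norm_of_nonneg (by positivity),
          Real.norm_of_nonneg (by positivity)]
        exact mul_le_of_le_one_right (by positivity) (norm_invSqrtCoeff_le_one k)
      calc _ ≤ μ⁻¹ * (μ⁻¹ ^ 2) ^ k * (T ^ (2 * k) / (2 * k).factorial) * ‖f‖ := by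
            gcongr
            exact f.norm_coe_le_norm _
        _ = _ := by rw [div_pow, ← pow_mul, inv_pow]; field_simp
    · exact (((Real.summable_pow_div_factorial (T / μ)).comp_injective
        (mul_right_injective₀ two_ne_zero)).mul_left _).mul_right _
  refine h2.unique (h3.congr_fun fun k => ?_)
  rw [← intervalIntegral.integral_const_mul]
  exact intervalIntegral.integral_congr fun s _ => by ring

/-! ### The reflection operator (1 - B)/(1 + B). -/

section BanachAlgebra

variable {A : Type*} [NormedRing A] [NormedAlgebra ℝ A]

/-- The operator `(1 - B) / (1 + B)` with `B = J (μ² + J²) ^ (-1 / 2)`. -/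
def reflectionOp (μ : ℝ) (J : A) : A :=
  1 - (2 : ℝ) • (J * invSqrtOp μ J) - (2 / μ ^ 2) • (J ^ 2 * (J * invSqrtOp μ J - 1))

variable {J : A} {c μ : ℝ}

theorem sq_mul_invSqrtOp [CompleteSpace A] (hμ : 0 < μ) (hJ : ∀ n, ‖J ^ n‖ ≤ c ^ n / n.factorial) :
    (J * invSqrtOp μ J) * (J * invSqrtOp μ J) * (μ ^ 2 • (1 : A) + J ^ 2) = J ^ 2 := by
  have h := invSqrtOp_mul_self_mul hμ hJ
  have hc := (commute_invSqrtOp (J := J) μ).eq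
  calc _ = J * (invSqrtOp μ J * J) * invSqrtOp μ J * (μ ^ 2 • (1 : A) + J ^ 2) := by
        simp only [mul_assoc]
    _ = J ^ 2 * (invSqrtOp μ J * invSqrtOp μ J * (μ ^ 2 • (1 : A) + J ^ 2)) := by
        rw [← hc, pow_two J]
        simp only [mul_assoc]
    _ = J ^ 2 := by rw [h, mul_one]

/-- Since B² (μ² + J²) = J², one has 1 - B² = μ² (μ² + J²)⁻¹. Thus (1 - B)/(1 + B) = (1 - B)² (μ² +
J²)/μ², which expands to the polynomial in B and J defining `reflectionOp`; no inverse of 1 + B is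
required. -/
theorem one_add_mul_reflectionOp [CompleteSpace A] (hμ : 0 < μ) (hJ : ∀ n, ‖J ^ n‖ ≤ c ^ n / n.factorial) :
    (1 + J * invSqrtOp μ J) * reflectionOp μ J = 1 - J * invSqrtOp μ J := by
  have h := sq_mul_invSqrtOp hμ hJ
  rw [reflectionOp]
  have hc : Commute (J * invSqrtOp μ J) (J ^ 2) :=
    (((Commute.refl J).mul_right (commute_invSqrtOp μ)).symm).pow_right 2
  set B := J * invSqrtOp μ J with hB
  have h2 : J ^ 2 - B * (J ^ 2 * B) = μ ^ 2 • (B * B) := by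
    rw [← hc.eq, ← mul_assoc, sub_eq_iff_eq_add]
    nth_rw 1 [← h]
    rw [mul_add, mul_smul_comm, mul_one]
  have h3 : (2 / μ ^ 2) • (J ^ 2 - B * (J ^ 2 * B)) = (2 : ℝ) • (B * B) := by
    rw [h2, smul_smul]
    congr 1
    field_simp
  have hc' := hc.eq
  calc (1 + B) * (1 - (2 : ℝ) • B - (2 / μ ^ 2) • (J ^ 2 * (B - 1)))
      = 1 - B - (2 : ℝ) • (B * B) + (2 / μ ^ 2) • (J ^ 2 - B * (J ^ 2 * B))
        + (2 / μ ^ 2) • (B * J ^ 2 - J ^ 2 * B) := by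
        simp only [mul_sub, add_mul, mul_add, one_mul, mul_one, smul_sub, smul_add, mul_smul_comm, two_smul]
        abel
    _ = 1 - B := by rw [h3, hc', sub_self, smul_zero]; abel

theorem commute_reflectionOp : Commute (J * invSqrtOp μ J) (reflectionOp μ J) := by
  have hc : Commute (J * invSqrtOp μ J) (J ^ 2) :=
    (((Commute.refl J).mul_right (commute_invSqrtOp μ)).symm).pow_right 2
  have hB := Commute.refl (J * invSqrtOp μ J)
  exact ((Commute.one_right _).sub_right (hB.smul_right _)).sub_right
    ((hc.mul_right (hB.sub_right (Commute.one_right _))).smul_right _)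

end BanachAlgebra

/-- The restriction of a continuous function to `[0, T]`. -/
def restrictIcc (T : ℝ) {f : ℝ → ℝ} (hf : Continuous f) : C(Icc (0 : ℝ) T, ℝ) :=
  ⟨fun t => f t, hf.comp continuous_subtype_val⟩

theorem IccExtend_restrictIcc {T : ℝ} (hT : 0 ≤ T) {f : ℝ → ℝ} (hf : Continuous f) :
    ∀ s ∈ Icc 0 T, IccExtend hT (restrictIcc T hf) s = f s := fun s hs => by
  rw [IccExtend_of_mem hT _ hs]
  rfl

theorem primOp_restrictIcc {T : ℝ} (hT : 0 ≤ T) {f : ℝ → ℝ} (hf : Continuous f) :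
    primOp hT (restrictIcc T hf) = restrictIcc T (continuous_primitive hf) := by
  ext t
  rw [primOp_apply]
  exact primitive_congr (IccExtend_restrictIcc hT hf) t.2

/-- The operator `J (μ² + J²) ^ (-1 / 2)` on `C([0, T])`, where `J` is the integration in time. -/
def besselOp (μ : ℝ) {T : ℝ} (hT : 0 ≤ T) : C(Icc (0 : ℝ) T, ℝ) →L[ℝ] C(Icc (0 : ℝ) T, ℝ) :=
  primOp hT * invSqrtOp μ (primOp hT)

theorem besselOp_restrictIcc {μ T : ℝ} (hμ : 0 < μ) (hT : 0 ≤ T) {f : ℝ → ℝ} (hf : Continuous f) :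
    besselOp μ hT (restrictIcc T hf) =
      restrictIcc T (continuous_volterra (continuous_besselKernel μ) hf) := by
  ext t
  rw [besselOp, primOp_mul_invSqrtOp_apply hμ]
  exact volterra_congr (IccExtend_restrictIcc hT hf) t.2

/-- An operator identity on C([0, t]) is evaluated at the end point t. As t is arbitrary, it becomes
a pointwise identity on the half-line; the next identities are transferred in the same way. -/
theorem volterra_primitive {μ : ℝ} (hμ : 0 < μ) {f : ℝ → ℝ} (hf : Continuous f) {t : ℝ}
    (ht : 0 ≤ t) : volterra (besselKernel μ) (primitive f) t =
      primitive (volterra (besselKernel μ) f) t := by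
  have h : besselOp μ ht * primOp ht = primOp ht * besselOp μ ht := by
    rw [besselOp, mul_assoc, (commute_invSqrtOp (J := primOp ht) μ).eq]
  have h1 : besselOp μ ht (primOp ht (restrictIcc t hf)) =
    primOp ht (besselOp μ ht (restrictIcc t hf)) := DFunLike.congr_fun h _
  rw [primOp_restrictIcc, besselOp_restrictIcc hμ, besselOp_restrictIcc hμ,
    primOp_restrictIcc] at h1
  exact DFunLike.congr_fun h1 ⟨t, ht, le_rfl⟩

theorem volterra_volterra {μ : ℝ} (hμ : 0 < μ) {f : ℝ → ℝ} (hf : Continuous f) {t : ℝ}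
    (ht : 0 ≤ t) :
    volterra (besselKernel μ) (volterra (besselKernel μ)
      (fun s => μ ^ 2 * f s + primitive (primitive f) s)) t = primitive (primitive f) t := by
  have h := sq_mul_invSqrtOp hμ (J := primOp ht) (norm_primOp_pow_le ht)
  have hc : Continuous (fun s => μ ^ 2 * f s + primitive (primitive f) s) :=
    (hf.const_mul _).add (continuous_primitive (continuous_primitive hf))
  have h1 : μ ^ 2 • restrictIcc t hf + primOp ht (primOp ht (restrictIcc t hf)) =
      restrictIcc t hc := by
    rw [primOp_restrictIcc, primOp_restrictIcc]
    rfl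
  rw [pow_two (primOp ht)] at h
  have h2 : besselOp μ ht (besselOp μ ht
      (μ ^ 2 • restrictIcc t hf + primOp ht (primOp ht (restrictIcc t hf)))) =
      primOp ht (primOp ht (restrictIcc t hf)) := DFunLike.congr_fun h _
  rw [h1, besselOp_restrictIcc hμ, besselOp_restrictIcc hμ, primOp_restrictIcc,
    primOp_restrictIcc] at h2
  exact DFunLike.congr_fun h2 ⟨t, ht, le_rfl⟩

/-- The causal filter with symbol `(1 - S) / (1 + S)`, where `S = 1 / √(1 + μ² s²)`. -/
def reflect (μ : ℝ) (f : ℝ → ℝ) (t : ℝ) : ℝ :=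
  f t - 2 * volterra (besselKernel μ) f t -
    2 / μ ^ 2 * primitive (primitive (fun s => volterra (besselKernel μ) f s - f s)) t

theorem continuous_reflect (μ : ℝ) {f : ℝ → ℝ} (hf : Continuous f) : Continuous (reflect μ f) := by
  have h := continuous_volterra (continuous_besselKernel μ) hf
  exact (hf.sub (h.const_mul _)).sub
    ((continuous_primitive (continuous_primitive (h.sub hf))).const_mul _)

theorem reflectionOp_restrictIcc {μ T : ℝ} (hμ : 0 < μ) (hT : 0 ≤ T) {f : ℝ → ℝ}
    (hf : Continuous f) :
    reflectionOp μ (primOp hT) (restrictIcc T hf) = restrictIcc T (continuous_reflect μ hf) := by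
  have h := continuous_volterra (continuous_besselKernel μ) hf
  have e : besselOp μ hT (restrictIcc T hf) - restrictIcc T hf = restrictIcc T (h.sub hf) := by
    rw [besselOp_restrictIcc hμ]
    rfl
  have e2 : reflectionOp μ (primOp hT) (restrictIcc T hf) = restrictIcc T hf -
      (2 : ℝ) • besselOp μ hT (restrictIcc T hf) - (2 / μ ^ 2) •
      primOp hT (primOp hT (besselOp μ hT (restrictIcc T hf) - restrictIcc T hf)) := by
    rw [reflectionOp, pow_two (primOp hT)]
    rfl
  rw [e2, e, besselOp_restrictIcc hμ, primOp_restrictIcc, primOp_restrictIcc]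
  rfl

theorem reflect_add_volterra {μ : ℝ} (hμ : 0 < μ) {f : ℝ → ℝ} (hf : Continuous f) {t : ℝ}
    (ht : 0 ≤ t) :
    reflect μ f t + volterra (besselKernel μ) (reflect μ f) t =
      f t - volterra (besselKernel μ) f t := by
  have h := one_add_mul_reflectionOp hμ (J := primOp ht) (norm_primOp_pow_le ht)
  have h2 : reflectionOp μ (primOp ht) (restrictIcc t hf) +
      besselOp μ ht (reflectionOp μ (primOp ht) (restrictIcc t hf)) =
      restrictIcc t hf - besselOp μ ht (restrictIcc t hf) := DFunLike.congr_fun h _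
  rw [reflectionOp_restrictIcc hμ, besselOp_restrictIcc hμ, besselOp_restrictIcc hμ] at h2
  exact DFunLike.congr_fun h2 ⟨t, ht, le_rfl⟩

/-- The equation `(1 + B) v = 2 f` has the solution `v = f + (1 - B) / (1 + B) f`. -/
theorem eq_add_reflect {μ T : ℝ} (hμ : 0 < μ) (hT : 0 ≤ T) {f : ℝ → ℝ} (hf : Continuous f)
    (v : C(Icc (0 : ℝ) T, ℝ))
    (hv : ∀ t, v t + besselOp μ hT v t = 2 * f t) (t : Icc (0 : ℝ) T) :
    v t = f t + reflect μ f t := by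
  set B := besselOp μ hT with hB
  set R := reflectionOp μ (primOp hT) with hR
  have h1 : (1 + B) * R = 1 - B :=
    one_add_mul_reflectionOp hμ (J := primOp hT) (norm_primOp_pow_le hT)
  have hc : B * R = R * B := commute_reflectionOp (J := primOp hT) (μ := μ)
  have hv' : v + B v = restrictIcc T hf + restrictIcc T hf := by
    ext t
    exact (hv t).trans (two_mul _)
  -- Half of 1 + R is a left inverse of 1 + B, so applying 1 + R to the equation determines v.
  have h2 : (1 + R) * (1 + B) = 1 + 1 := by
    rw [add_mul, one_mul] at h1
    rw [add_mul, one_mul, mul_add, ← hc, mul_one, h1]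
    abel
  have h3 : (v + B v) + R (v + B v) = v + v := DFunLike.congr_fun h2 v
  rw [hv', map_add, hR, reflectionOp_restrictIcc hμ] at h3
  have h4 : (f t + f t) + (reflect μ f t + reflect μ f t) = v t + v t := DFunLike.congr_fun h3 t
  linarith

/-! ### Positivity, energy and regularity of the causal filter. -/

/-- By the addition formula for cos(a(t - s)), the integrand is the derivative of (C² + S²)/2, where
C and S are the primitives of cos(as) p and sin(as) p. A cosine kernel is therefore of positive
type. -/
theorem integral_mul_volterra_cos {p : ℝ → ℝ} (hp : Continuous p) (a X : ℝ) :
    ∫ t in (0 : ℝ)..X, p t * ∫ s in (0 : ℝ)..t, Real.cos (a * (t - s)) * p s =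
      ((∫ s in (0 : ℝ)..X, Real.cos (a * s) * p s) ^ 2 +
        (∫ s in (0 : ℝ)..X, Real.sin (a * s) * p s) ^ 2) / 2 := by
  set C : ℝ → ℝ := primitive fun s => Real.cos (a * s) * p s with hC
  set S : ℝ → ℝ := primitive fun s => Real.sin (a * s) * p s with hS
  have hc : Continuous fun s => Real.cos (a * s) * p s := by fun_prop
  have hs : Continuous fun s => Real.sin (a * s) * p s := by fun_prop
  have hCd : ∀ t, HasDerivAt C (Real.cos (a * t) * p t) t := fun t =>
    (hc.integral_hasStrictDerivAt 0 t).hasDerivAt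
  have hSd : ∀ t, HasDerivAt S (Real.sin (a * t) * p t) t := fun t =>
    (hs.integral_hasStrictDerivAt 0 t).hasDerivAt
  have hCc : Continuous C := continuous_primitive hc
  have hSc : Continuous S := continuous_primitive hs
  have e : ∀ t, p t * ∫ s in (0 : ℝ)..t, Real.cos (a * (t - s)) * p s =
      Real.cos (a * t) * p t * C t + Real.sin (a * t) * p t * S t := by
    intro t
    have : ∫ s in (0 : ℝ)..t, Real.cos (a * (t - s)) * p s =
        Real.cos (a * t) * C t + Real.sin (a * t) * S t := by
      rw [hC, hS, primitive, primitive, ← intervalIntegral.integral_const_mul,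
        ← intervalIntegral.integral_const_mul, ← intervalIntegral.integral_add
        ((hc.const_mul _).intervalIntegrable _ _) ((hs.const_mul _).intervalIntegrable _ _)]
      refine intervalIntegral.integral_congr fun s _ => ?_
      simp only [mul_sub, Real.cos_sub]
      ring
    rw [this]
    ring
  have hd : ∀ t ∈ uIcc 0 X, HasDerivAt (fun t => (C t ^ 2 + S t ^ 2) / 2)
      (Real.cos (a * t) * p t * C t + Real.sin (a * t) * p t * S t) t := by
    intro t _
    have h := (((hCd t).pow 2).add ((hSd t).pow 2)).div_const 2
    convert! h using 1
    simp
    ring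
  simp_rw [e]
  rw [intervalIntegral.integral_eq_sub_of_hasDerivAt hd
    (Continuous.intervalIntegrable (by fun_prop) _ _)]
  simp [hC, hS, primitive]

/-- The Bessel kernel is of positive type. -/
theorem integral_mul_volterra_besselKernel_nonneg {μ : ℝ} (hμ : 0 < μ) {p : ℝ → ℝ}
    (hp : Continuous p) (X : ℝ) :
    0 ≤ ∫ t in (0 : ℝ)..X, p t * volterra (besselKernel μ) p t := by
  -- The Bessel kernel is an average over θ of the kernels cos((sin θ/μ) t), so Fubini reduces
  -- positivity to that of cosines.
  have hv : ∀ t, volterra (besselKernel μ) p t = (Real.pi * μ)⁻¹ *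
      ∫ θ in (0 : ℝ)..Real.pi, ∫ s in (0 : ℝ)..t, Real.cos (Real.sin θ / μ * (t - s)) * p s := by
    intro t
    have hcont : Continuous (Function.uncurry fun θ s : ℝ =>
        Real.cos (Real.sin θ / μ * (t - s)) * p s) := by
      simp only [Function.uncurry_def]
      fun_prop
    rw [intervalIntegral_intervalIntegral_swap
      ((hcont.continuousOn.integrableOn_compact (isCompact_uIcc.prod isCompact_uIcc)).mono_set
        (prod_mono uIoc_subset_uIcc uIoc_subset_uIcc)), volterra,
      ← intervalIntegral.integral_const_mul]
    refine intervalIntegral.integral_congr fun s _ => ?_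
    have e : ∀ θ, (t - s) / μ * Real.sin θ = Real.sin θ / μ * (t - s) := fun θ => by ring
    simp only [besselKernel, e, mul_assoc, intervalIntegral.integral_mul_const]
  have hcont : Continuous (Function.uncurry fun t θ : ℝ =>
      p t * ∫ s in (0 : ℝ)..t, Real.cos (Real.sin θ / μ * (t - s)) * p s) := by
    have : Continuous fun z : ℝ × ℝ =>
        ∫ s in (0 : ℝ)..z.1, Real.cos (Real.sin z.2 / μ * (z.1 - s)) * p s := by
      refine intervalIntegral.continuous_parametric_intervalIntegral_of_continuous
        (f := fun (z : ℝ × ℝ) s => Real.cos (Real.sin z.2 / μ * (z.1 - s)) * p s) ?_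
        continuous_fst
      simp only [Function.uncurry_def]
      fun_prop
    simp only [Function.uncurry_def]
    fun_prop
  have e : ∫ t in (0 : ℝ)..X, p t * volterra (besselKernel μ) p t = (Real.pi * μ)⁻¹ *
      ∫ θ in (0 : ℝ)..Real.pi, ∫ t in (0 : ℝ)..X,
        p t * ∫ s in (0 : ℝ)..t, Real.cos (Real.sin θ / μ * (t - s)) * p s := by
    rw [← intervalIntegral_intervalIntegral_swap
      ((hcont.continuousOn.integrableOn_compact (isCompact_uIcc.prod isCompact_uIcc)).mono_set
        (prod_mono uIoc_subset_uIcc uIoc_subset_uIcc)), ← intervalIntegral.integral_const_mul]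
    refine intervalIntegral.integral_congr fun t _ => ?_
    simp only [hv, intervalIntegral.integral_const_mul]
    ring
  rw [e]
  refine mul_nonneg (by positivity) (intervalIntegral.integral_nonneg Real.pi_pos.le fun θ _ => ?_)
  rw [integral_mul_volterra_cos hp]
  positivity

/-- The filter `reflect μ` does not increase the energy. -/
theorem integral_reflect_sq_le {μ : ℝ} (hμ : 0 < μ) {f : ℝ → ℝ} (hf : Continuous f) {X : ℝ}
    (hX : 0 ≤ X) :
    ∫ t in (0 : ℝ)..X, reflect μ f t ^ 2 ≤ ∫ t in (0 : ℝ)..X, f t ^ 2 := by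
  have hg := continuous_reflect μ hf
  have hK := continuous_besselKernel μ
  have hpos := integral_mul_volterra_besselKernel_nonneg hμ (hf.add hg) X
  -- With g = R f one has B(f + g) = f - g. Its product with f + g is f² - g², whose integral is
  -- nonnegative by positivity of B.
  have e : ∫ t in (0 : ℝ)..X, (f t + reflect μ f t) *
      volterra (besselKernel μ) (fun s => f s + reflect μ f s) t =
      ∫ t in (0 : ℝ)..X, (f t ^ 2 - reflect μ f t ^ 2) := by
    refine intervalIntegral.integral_congr fun t ht => ?_
    rw [uIcc_of_le hX] at ht
    have h1 := reflect_add_volterra hμ hf ht.1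
    have h2 : volterra (besselKernel μ) (fun s => f s + reflect μ f s) t =
        volterra (besselKernel μ) f t + volterra (besselKernel μ) (reflect μ f) t := by
      simp only [volterra, mul_add]
      exact intervalIntegral.integral_add (Continuous.intervalIntegrable (by fun_prop) _ _)
        (Continuous.intervalIntegrable (by fun_prop) _ _)
    simp only [h2]
    linear_combination (f t + reflect μ f t) * h1
  rw [intervalIntegral.integral_sub (Continuous.intervalIntegrable (by fun_prop) _ _)
    (Continuous.intervalIntegrable (by fun_prop) _ _)] at e
  have : 0 ≤ ∫ t in (0 : ℝ)..X, (f t + reflect μ f t) *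
      volterra (besselKernel μ) (fun s => f s + reflect μ f s) t := hpos
  linarith

theorem volterra_eq_zero {k f : ℝ → ℝ} (hf : ∀ t ≤ 0, f t = 0) {t : ℝ} (ht : t ≤ 0) :
    volterra k f t = 0 := by
  refine intervalIntegral.integral_zero_ae (ae_of_all _ fun s hs => ?_)
  rw [uIoc_of_ge ht] at hs
  rw [hf s hs.2, mul_zero]

theorem primitive_eq_zero {f : ℝ → ℝ} (hf : ∀ t ≤ 0, f t = 0) {t : ℝ} (ht : t ≤ 0) :
    primitive f t = 0 := by
  refine intervalIntegral.integral_zero_ae (ae_of_all _ fun s hs => ?_)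
  rw [uIoc_of_ge ht] at hs
  exact hf s hs.2

theorem reflect_eq_zero {μ : ℝ} {f : ℝ → ℝ} (hf : ∀ t ≤ 0, f t = 0) {t : ℝ} (ht : t ≤ 0) :
    reflect μ f t = 0 := by
  have h : ∀ t ≤ 0, volterra (besselKernel μ) f t - f t = 0 := fun t ht => by
    rw [volterra_eq_zero hf ht, hf t ht, sub_zero]
  rw [reflect, hf t ht, volterra_eq_zero hf ht,
    primitive_eq_zero (fun t ht => primitive_eq_zero h ht) ht]
  simp

theorem contDiff_primitive {f : ℝ → ℝ} (hf : Continuous f) : ContDiff ℝ 1 (primitive f) := by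
  have hd : ∀ t, HasDerivAt (primitive f) (f t) t := fun t =>
    (hf.integral_hasStrictDerivAt 0 t).hasDerivAt
  rw [contDiff_one_iff_deriv]
  refine ⟨fun t => (hd t).differentiableAt, ?_⟩
  rwa [show deriv (primitive f) = f from funext fun t => (hd t).deriv]

/-- As f(0) = 0, f is the primitive of f', and B commutes with integration; hence B f is the
primitive of the continuous function B f'. Both sides vanish for negative times. -/
theorem contDiff_volterra {μ : ℝ} (hμ : 0 < μ) {f : ℝ → ℝ} (hf : ContDiff ℝ 1 f)
    (hf0 : ∀ t ≤ 0, f t = 0) : ContDiff ℝ 1 (volterra (besselKernel μ) f) := by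
  have hc : Continuous (deriv f) := hf.continuous_deriv le_rfl
  have hfd : ∀ t, HasDerivAt f (deriv f t) t := fun t =>
    (hf.differentiable one_ne_zero t).hasDerivAt
  have hp : f = primitive (deriv f) := by
    ext t
    rw [primitive, intervalIntegral.integral_eq_sub_of_hasDerivAt (fun s _ => hfd s)
      (hc.intervalIntegrable _ _), hf0 0 le_rfl, sub_zero]
  have hd0 : ∀ t ≤ 0, deriv f t = 0 := by
    intro t ht
    have h1 : HasDerivWithinAt f (deriv f t) (Iic t) t := (hfd t).hasDerivWithinAt
    have h2 : HasDerivWithinAt f 0 (Iic t) t :=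
      (hasDerivWithinAt_const t (Iic t) (0 : ℝ)).congr (fun s hs => hf0 s (hs.trans ht)) (hf0 t ht)
    exact (uniqueDiffOn_Iic t t self_mem_Iic).eq_deriv _ h1 h2
  have e : volterra (besselKernel μ) f = primitive (volterra (besselKernel μ) (deriv f)) := by
    ext t
    rcases le_total 0 t with ht | ht
    · rw [← volterra_primitive hμ hc ht, ← hp]
    · rw [volterra_eq_zero hf0 ht, primitive_eq_zero (fun s hs => volterra_eq_zero hd0 hs) ht]
  rw [e]
  exact contDiff_primitive (continuous_volterra (continuous_besselKernel μ) hc)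

theorem contDiff_reflect {μ : ℝ} (hμ : 0 < μ) {f : ℝ → ℝ} (hf : ContDiff ℝ 1 f)
    (hf0 : ∀ t ≤ 0, f t = 0) : ContDiff ℝ 1 (reflect μ f) := by
  have h := contDiff_volterra hμ hf hf0
  exact (hf.sub (contDiff_const.mul h)).sub (contDiff_const.mul
    (contDiff_primitive (continuous_primitive (h.continuous.sub hf.continuous))))

theorem memLp_reflect {μ : ℝ} (hμ : 0 < μ) {f : ℝ → ℝ} (hf : Continuous f)
    (hf0 : ∀ t ≤ 0, f t = 0) (hL : MemLp f 2 (volume : Measure ℝ)) :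
    MemLp (reflect μ f) 2 (volume : Measure ℝ) := by
  have hg := continuous_reflect μ hf
  rw [memLp_two_iff_integrable_sq hg.aestronglyMeasurable]
  have hfi := (memLp_two_iff_integrable_sq hf.aestronglyMeasurable).1 hL
  have h1 : IntegrableOn (fun t => reflect μ f t ^ 2) (Ioi 0) := by
    refine integrableOn_Ioi_of_intervalIntegral_norm_bounded (∫ t, f t ^ 2) 0
      (b := id) (l := atTop) (fun X => ((hg.pow 2).integrableOn_Icc).mono_set Ioc_subset_Icc_self)
      tendsto_id ?_
    filter_upwards [eventually_ge_atTop 0] with X hX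
    have e : ∫ t in (0 : ℝ)..X, ‖reflect μ f t ^ 2‖ = ∫ t in (0 : ℝ)..X, reflect μ f t ^ 2 :=
      intervalIntegral.integral_congr fun t _ => Real.norm_of_nonneg (sq_nonneg _)
    simp only [id]
    rw [e]
    refine (integral_reflect_sq_le hμ hf hX).trans ?_
    rw [intervalIntegral.integral_of_le hX]
    exact setIntegral_le_integral hfi (ae_of_all _ fun t => sq_nonneg _)
  have h2 : IntegrableOn (fun t => reflect μ f t ^ 2) (Iic 0) := by
    refine integrableOn_zero.congr_fun (fun t ht => ?_) measurableSet_Iic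
    rw [reflect_eq_zero hf0 ht]
    simp
  rw [← integrableOn_univ, ← Iic_union_Ioi (a := (0 : ℝ))]
  exact h2.union h1

/-! ### Laplace transforms of the kernel and of the filter. -/

/-- The Laplace transform of `f`. -/
def laplace (f : ℝ → ℝ) (s : ℂ) : ℂ := ∫ t in Ioi (0 : ℝ), Complex.exp (-s * t) * (f t : ℂ)

/-- The integral defining the Laplace transform converges absolutely. -/
def LaplaceIntegrable (f : ℝ → ℝ) (s : ℂ) : Prop :=
  IntegrableOn (fun t : ℝ => Complex.exp (-s * t) * (f t : ℂ)) (Ioi 0)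

theorem exp_mul_volterra (k f : ℝ → ℝ) (s : ℂ) (x : ℝ) :
    Complex.exp (-s * x) * (volterra k f x : ℂ) =
      ∫ t in (0 : ℝ)..x, ContinuousLinearMap.mul ℝ ℂ (Complex.exp (-s * t) * (f t : ℂ))
        (Complex.exp (-s * (x - t : ℝ)) * (k (x - t) : ℂ)) := by
  rw [volterra, ← intervalIntegral.integral_ofReal, ← intervalIntegral.integral_const_mul]
  refine intervalIntegral.integral_congr fun t _ => ?_
  have e : Complex.exp (-s * x) = Complex.exp (-s * t) * Complex.exp (-s * (x - t : ℝ)) := by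
    rw [← Complex.exp_add]
    congr 1
    push_cast
    ring
  simp only [ContinuousLinearMap.mul_apply', e]
  push_cast
  ring

theorem laplace_volterra {k f : ℝ → ℝ} {s : ℂ} (hk : LaplaceIntegrable k s)
    (hf : LaplaceIntegrable f s) :
    laplace (volterra k f) s = laplace k s * laplace f s := by
  have h := integral_posConvolution hf hk (ContinuousLinearMap.mul ℝ ℂ)
  simp only [laplace, exp_mul_volterra]
  rw [mul_comm]
  exact h

theorem LaplaceIntegrable.volterra {k f : ℝ → ℝ} {s : ℂ} (hk : LaplaceIntegrable k s)
    (hf : LaplaceIntegrable f s) : LaplaceIntegrable (volterra k f) s := by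
  have h := integrable_posConvolution hf hk (ContinuousLinearMap.mul ℝ ℂ)
  rw [posConvolution, integrable_indicator_iff measurableSet_Ioi] at h
  simp only [LaplaceIntegrable, exp_mul_volterra]
  exact h

theorem laplaceIntegrable_of_bounded {f : ℝ → ℝ} (hf : Continuous f) {C : ℝ}
    (hC : ∀ t, |f t| ≤ C) {s : ℂ} (hs : 0 < s.re) : LaplaceIntegrable f s := by
  have h := integrableOn_exp_mul_complex_Ioi (a := -s) (by simpa using hs) 0
  refine Integrable.mul_bdd (c := C) h
    (Continuous.aestronglyMeasurable (by fun_prop)) (ae_of_all _ fun t => ?_)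
  rw [Complex.norm_real]
  exact hC t

theorem laplace_congr {f g : ℝ → ℝ} (h : ∀ t, 0 ≤ t → f t = g t) (s : ℂ) :
    laplace f s = laplace g s :=
  setIntegral_congr_fun measurableSet_Ioi fun t ht => by simp only [h t (mem_Ioi.1 ht).le]

theorem sq_add_sq_ne_zero {s : ℂ} (hs : 0 < s.re) (a : ℝ) : s ^ 2 + (a : ℂ) ^ 2 ≠ 0 := by
  have e : s ^ 2 + (a : ℂ) ^ 2 = (s + a * Complex.I) * (s - a * Complex.I) := by
    ring_nf
    simp
  rw [e]
  refine mul_ne_zero (fun h => ?_) fun h => ?_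
  · have := congrArg Complex.re h
    simp at this
    exact hs.ne' this
  · have := congrArg Complex.re h
    simp at this
    exact hs.ne' this

theorem laplace_cos {s : ℂ} (hs : 0 < s.re) (a : ℝ) :
    laplace (fun t => Real.cos (a * t)) s = s / (s ^ 2 + (a : ℂ) ^ 2) := by
  have h1 : (-s + a * Complex.I).re < 0 := by simpa using hs
  have h2 : (-s - a * Complex.I).re < 0 := by simpa using hs
  have e : ∀ t : ℝ, Complex.exp (-s * t) * (Real.cos (a * t) : ℂ) =
      (Complex.exp ((-s + a * Complex.I) * t) + Complex.exp ((-s - a * Complex.I) * t)) / 2 := by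
    intro t
    rw [Complex.ofReal_cos, Complex.cos, mul_div_assoc', mul_add, ← Complex.exp_add,
      ← Complex.exp_add]
    congr 3 <;> (push_cast; ring)
  simp only [laplace, e]
  rw [integral_div, integral_add (integrableOn_exp_mul_complex_Ioi h1 0)
    (integrableOn_exp_mul_complex_Ioi h2 0), integral_exp_mul_complex_Ioi h1,
    integral_exp_mul_complex_Ioi h2]
  have n1 : -s + a * Complex.I ≠ 0 := fun h => by rw [h] at h1; simp at h1
  have n2 : -s - a * Complex.I ≠ 0 := fun h => by rw [h] at h2; simp at h2
  have n3 := sq_add_sq_ne_zero hs a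
  simp only [Complex.ofReal_zero, mul_zero, Complex.exp_zero]
  field_simp
  ring_nf
  simp

theorem re_div_sq_add_sq_pos {s : ℂ} (hs : 0 < s.re) (a : ℝ) :
    0 < (s / (s ^ 2 + (a : ℂ) ^ 2)).re := by
  have hn := sq_add_sq_ne_zero hs a
  rw [Complex.div_re, ← add_div]
  refine div_pos ?_ (Complex.normSq_pos.2 hn)
  simp only [pow_two, Complex.add_re, Complex.mul_re, Complex.add_im, Complex.mul_im,
    Complex.ofReal_re, Complex.ofReal_im]
  have : s.re * (s.re * s.re - s.im * s.im + (a * a - 0 * 0)) +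
      s.im * (s.re * s.im + s.im * s.re + (a * 0 + 0 * a)) =
      s.re * (s.re ^ 2 + s.im ^ 2 + a ^ 2) := by ring
  rw [this]
  positivity

theorem laplaceIntegrable_besselKernel {μ : ℝ} (hμ : 0 < μ) {s : ℂ} (hs : 0 < s.re) :
    LaplaceIntegrable (besselKernel μ) s :=
  laplaceIntegrable_of_bounded (continuous_besselKernel μ) (abs_besselKernel_le hμ) hs

/-- Positivity in the Laplace domain: the transform is an average of the functions s/(s² + a²),
which have positive real part for Re s > 0. It fixes the sign of the square root in
`laplace_besselKernel`. -/
theorem re_laplace_besselKernel_nonneg {μ : ℝ} (hμ : 0 < μ) {s : ℂ} (hs : 0 < s.re) :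
    0 ≤ (laplace (besselKernel μ) s).re := by
  have hint : Integrable (Function.uncurry fun (t θ : ℝ) =>
      Complex.exp (-s * t) * (Real.cos (Real.sin θ / μ * t) : ℂ))
      ((volume.restrict (Ioi 0)).prod (volume.restrict (Ioc 0 Real.pi))) := by
    have h1 : Integrable (fun z : ℝ × ℝ => Complex.exp (-s * z.1) * 1)
        ((volume.restrict (Ioi 0)).prod (volume.restrict (Ioc 0 Real.pi))) := by
      refine Integrable.mul_prod (f := fun t : ℝ => Complex.exp (-s * t)) (g := fun _ => (1 : ℂ))
        (integrableOn_exp_mul_complex_Ioi (a := -s) (by simpa using hs) 0) ?_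
      exact integrableOn_const (by simp)
    refine h1.mono ?_ (ae_of_all _ fun z => ?_)
    · refine Continuous.aestronglyMeasurable ?_
      simp only [Function.uncurry_def]
      fun_prop
    · simp only [Function.uncurry_def, norm_mul, Complex.norm_real, norm_one]
      gcongr
      exact Real.abs_cos_le_one _
  have e : laplace (besselKernel μ) s = ((Real.pi * μ)⁻¹ : ℝ) *
      ∫ θ in (0 : ℝ)..Real.pi, s / (s ^ 2 + ((Real.sin θ / μ : ℝ) : ℂ) ^ 2) := by
    rw [← intervalIntegral.integral_congr (fun θ _ => laplace_cos hs (Real.sin θ / μ))]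
    simp only [laplace]
    rw [intervalIntegral.integral_of_le Real.pi_pos.le, ← integral_integral_swap hint,
      ← integral_const_mul]
    refine setIntegral_congr_fun measurableSet_Ioi fun t _ => ?_
    have e : ∀ θ, t / μ * Real.sin θ = Real.sin θ / μ * t := fun θ => by ring
    simp only [besselKernel, e, integral_const_mul, intervalIntegral.integral_of_le Real.pi_pos.le]
    have e2 : ∫ θ in Ioc 0 Real.pi, (Real.cos (Real.sin θ / μ * t) : ℂ) =
        ((∫ θ in Ioc 0 Real.pi, Real.cos (Real.sin θ / μ * t) : ℝ) : ℂ) := integral_ofReal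
    rw [e2]
    push_cast
    ring
  have hcont : Continuous fun θ : ℝ => s / (s ^ 2 + ((Real.sin θ / μ : ℝ) : ℂ) ^ 2) :=
    continuous_const.div (by fun_prop) fun θ => sq_add_sq_ne_zero hs _
  rw [e, Complex.re_ofReal_mul]
  refine mul_nonneg (by positivity) ?_
  have h := Complex.reCLM.intervalIntegral_comp_comm (hcont.intervalIntegrable (μ := volume) 0 Real.pi)
  refine le_of_le_of_eq ?_ h
  exact intervalIntegral.integral_nonneg Real.pi_pos.le fun θ _ => (re_div_sq_add_sq_pos hs _).le

theorem primitive_primitive_cos {μ : ℝ} (hμ : 0 < μ) (t : ℝ) :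
    primitive (primitive fun s => Real.cos (1 / μ * s) / μ ^ 2) t = 1 - Real.cos (1 / μ * t) := by
  have h1 : primitive (fun s => Real.cos (1 / μ * s) / μ ^ 2) =
      fun t => Real.sin (1 / μ * t) / μ := by
    ext t
    have hd : ∀ s ∈ uIcc 0 t, HasDerivAt (fun s => Real.sin (1 / μ * s) / μ)
        (Real.cos (1 / μ * s) / μ ^ 2) s := by
      intro s _
      have h := (((hasDerivAt_id s).const_mul (1 / μ)).sin).div_const μ
      convert! h using 1
      simp only [id]
      field_simp
    rw [primitive, intervalIntegral.integral_eq_sub_of_hasDerivAt hd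
      (Continuous.intervalIntegrable (by fun_prop) _ _)]
    simp
  have hd : ∀ s ∈ uIcc 0 t, HasDerivAt (fun s => -Real.cos (1 / μ * s))
      (Real.sin (1 / μ * s) / μ) s := by
    intro s _
    have h := (((hasDerivAt_id s).const_mul (1 / μ)).cos).neg
    convert! h using 1
    simp only [id]
    field_simp
  rw [h1, primitive, intervalIntegral.integral_eq_sub_of_hasDerivAt hd
    (Continuous.intervalIntegrable (by fun_prop) _ _)]
  simp
  ring

/-- The function f = cos(t/μ)/μ² satisfies μ² f + J² f = 1, so B² applied to 1 equals J² f = 1 -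
cos(t/μ). Taking Laplace transforms gives S²/s = 1/s - s/(s² + 1/μ²). The constant 1 is written as a
cosine of frequency 0 so that `laplace_cos` covers both terms. -/
theorem laplace_besselKernel_sq {μ : ℝ} (hμ : 0 < μ) {s : ℂ} (hs : 0 < s.re) :
    laplace (besselKernel μ) s ^ 2 * (1 + (μ : ℂ) ^ 2 * s ^ 2) = 1 := by
  have hs0 : s ≠ 0 := fun h => by simp [h] at hs
  have hK := laplaceIntegrable_besselKernel hμ hs
  have hcb : ∀ a, LaplaceIntegrable (fun t => Real.cos (a * t)) s := fun a =>
    laplaceIntegrable_of_bounded (by fun_prop) (C := 1) (fun t => Real.abs_cos_le_one _) hs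
  have e1 : (fun s => μ ^ 2 * (Real.cos (1 / μ * s) / μ ^ 2) +
      primitive (primitive fun s => Real.cos (1 / μ * s) / μ ^ 2) s) =
      fun s => Real.cos (0 * s) := by
    ext s
    rw [primitive_primitive_cos hμ]
    simp
    field_simp
    ring
  have h : ∀ t, 0 ≤ t → volterra (besselKernel μ) (volterra (besselKernel μ)
      fun s => Real.cos (0 * s)) t = Real.cos (0 * t) - Real.cos (1 / μ * t) := by
    intro t ht
    have := volterra_volterra hμ (f := fun s => Real.cos (1 / μ * s) / μ ^ 2) (by fun_prop) ht
    rw [e1, primitive_primitive_cos hμ] at this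
    rw [this]
    simp
  have h2 := laplace_congr h s
  rw [laplace_volterra hK (hK.volterra (hcb 0)), laplace_volterra hK (hcb 0)] at h2
  have e2 : laplace (fun t => Real.cos (0 * t) - Real.cos (1 / μ * t)) s =
      laplace (fun t => Real.cos (0 * t)) s - laplace (fun t => Real.cos (1 / μ * t)) s := by
    rw [laplace, laplace, laplace, ← integral_sub (hcb 0) (hcb (1 / μ))]
    refine setIntegral_congr_fun measurableSet_Ioi fun t _ => ?_
    simp only [Complex.ofReal_sub]
    ring
  rw [e2, laplace_cos hs, laplace_cos hs] at h2
  have n := sq_add_sq_ne_zero hs (1 / μ)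
  have hμ' : (μ : ℂ) ≠ 0 := by exact_mod_cast hμ.ne'
  have n1 : 1 + (μ : ℂ) ^ 2 * s ^ 2 ≠ 0 := by
    intro h
    apply n
    push_cast
    field_simp
    linear_combination h
  have n3 : s ^ 2 + ((1 / μ : ℝ) : ℂ) ^ 2 = (1 + (μ : ℂ) ^ 2 * s ^ 2) / (μ : ℂ) ^ 2 := by
    push_cast
    field_simp
    ring
  rw [n3] at h2
  obtain ⟨X, hX⟩ : ∃ X : ℂ, X = 1 + (μ : ℂ) ^ 2 * s ^ 2 := ⟨_, rfl⟩
  rw [← hX] at h2 n1 ⊢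
  simp only [Complex.ofReal_zero, zero_pow two_ne_zero, add_zero] at h2
  field_simp at h2
  linear_combination h2 + hX

theorem one_add_sq_mem_slitPlane {μ : ℝ} (hμ : 0 < μ) {s : ℂ} (hs : 0 < s.re) :
    1 + (μ : ℂ) ^ 2 * s ^ 2 ∈ Complex.slitPlane := by
  rw [Complex.mem_slitPlane_iff]
  have e1 : (1 + (μ : ℂ) ^ 2 * s ^ 2).re = 1 + μ ^ 2 * (s.re ^ 2 - s.im ^ 2) := by
    rw [← Complex.ofReal_pow, Complex.add_re, Complex.re_ofReal_mul, pow_two s, Complex.mul_re,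
      Complex.one_re]
    ring
  have e2 : (1 + (μ : ℂ) ^ 2 * s ^ 2).im = μ ^ 2 * (2 * s.re * s.im) := by
    rw [← Complex.ofReal_pow, Complex.add_im, Complex.im_ofReal_mul, pow_two s, Complex.mul_im,
      Complex.one_im]
    ring
  rw [e1, e2]
  rcases eq_or_ne s.im 0 with h | h
  · left
    rw [h]
    nlinarith [mul_pos (pow_pos hμ 2) (pow_pos hs 2)]
  · right
    exact mul_ne_zero (by positivity) (mul_ne_zero (by positivity) h)

theorem cpow_half_sq (z : ℂ) : (z ^ (1 / 2 : ℂ)) ^ 2 = z := by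
  rw [← Complex.cpow_nat_mul]
  simp

theorem re_cpow_half_pos {z : ℂ} (hz : z ∈ Complex.slitPlane) : 0 < (z ^ (1 / 2 : ℂ)).re := by
  have hz0 := Complex.slitPlane_ne_zero hz
  rw [Complex.cpow_def_of_ne_zero hz0, Complex.exp_re]
  refine mul_pos (Real.exp_pos _) (Real.cos_pos_of_mem_Ioo ?_)
  have e : (Complex.log z * (1 / 2)).im = z.arg / 2 := by
    simp [Complex.log_im, Complex.mul_im]
    ring
  rw [e]
  have h1 := Complex.neg_pi_lt_arg z
  have h2 := (Complex.arg_le_pi z).lt_of_ne (Complex.mem_slitPlane_iff_arg.1 hz).1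
  constructor <;> linarith

/-- The Laplace transform of the Bessel kernel is `1 / √(1 + μ² s²)`. -/
theorem laplace_besselKernel {μ : ℝ} (hμ : 0 < μ) {s : ℂ} (hs : 0 < s.re) :
    laplace (besselKernel μ) s * (1 + (μ : ℂ) ^ 2 * s ^ 2) ^ (1 / 2 : ℂ) = 1 := by
  set S := laplace (besselKernel μ) s with hS
  set R := (1 + (μ : ℂ) ^ 2 * s ^ 2) ^ (1 / 2 : ℂ) with hR
  have h := laplace_besselKernel_sq hμ hs
  rw [← cpow_half_sq (1 + (μ : ℂ) ^ 2 * s ^ 2), ← hS, ← hR, ← mul_pow] at h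
  have hRpos : 0 < R.re := re_cpow_half_pos (one_add_sq_mem_slitPlane hμ hs)
  have hSpos : 0 ≤ S.re := re_laplace_besselKernel_nonneg hμ hs
  have h2 : (S * R - 1) * (S * R + 1) = 0 := by linear_combination h
  rcases mul_eq_zero.1 h2 with h3 | h3
  · linear_combination h3
  · exfalso
    -- If S R = -1, then S |R|² is minus the conjugate of R and has negative real part,
    -- contradicting Re S ≥ 0.
    have h4 : S * ((Complex.normSq R : ℝ) : ℂ) = -(starRingEnd ℂ) R := by
      rw [← Complex.mul_conj]
      linear_combination (starRingEnd ℂ) R * h3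
    have h5 := congrArg Complex.re h4
    rw [Complex.re_mul_ofReal, Complex.neg_re, Complex.conj_re] at h5
    nlinarith [mul_nonneg hSpos (Complex.normSq_nonneg R)]

theorem reflectionCoeff_eq {μ : ℝ} (hμ : 0 < μ) {s : ℂ} (hs : 0 < s.re) :
    reflectionCoeff μ s = (1 - laplace (besselKernel μ) s) / (1 + laplace (besselKernel μ) s) := by
  have hs0 : s ≠ 0 := fun h => by simp [h] at hs
  have h := laplace_besselKernel hμ hs
  have e0 : halfLineEigenvalue 0 s = s := by simp [halfLineEigenvalue]
  have e1 : halfLineEigenvalue μ s = s * laplace (besselKernel μ) s := by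
    rw [halfLineEigenvalue, div_eq_iff (right_ne_zero_of_mul_eq_one h), mul_assoc, h, mul_one]
  have e2 : s - s * laplace (besselKernel μ) s = s * (1 - laplace (besselKernel μ) s) := by ring
  have e3 : s + s * laplace (besselKernel μ) s = s * (1 + laplace (besselKernel μ) s) := by ring
  rw [reflectionCoeff, e0, e1, e2, e3, mul_div_mul_left _ _ hs0]

theorem laplace_add {f g : ℝ → ℝ} {s : ℂ} (hf : LaplaceIntegrable f s)
    (hg : LaplaceIntegrable g s) :
    laplace (fun t => f t + g t) s = laplace f s + laplace g s := by
  rw [laplace, laplace, laplace, ← integral_add hf hg]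
  refine setIntegral_congr_fun measurableSet_Ioi fun t _ => ?_
  simp only [Complex.ofReal_add]
  ring

theorem laplace_reflect {μ : ℝ} (hμ : 0 < μ) {f : ℝ → ℝ} (hf : Continuous f) {s : ℂ}
    (hs : 0 < s.re) (hfi : LaplaceIntegrable f s) (hgi : LaplaceIntegrable (reflect μ f) s) :
    laplace (reflect μ f) s = reflectionCoeff μ s * laplace f s := by
  have hK := laplaceIntegrable_besselKernel hμ hs
  have h : ∀ t, 0 ≤ t → reflect μ f t + volterra (besselKernel μ) (reflect μ f) t +
      volterra (besselKernel μ) f t = f t := fun t ht => by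
    rw [reflect_add_volterra hμ hf ht]
    ring
  have h2 := laplace_congr h s
  have hadd : LaplaceIntegrable
      (fun t => reflect μ f t + volterra (besselKernel μ) (reflect μ f) t) s := by
    refine (Integrable.add hgi (hK.volterra hgi)).congr (ae_of_all _ fun t => ?_)
    simp only [Complex.ofReal_add, Pi.add_apply]
    ring
  rw [laplace_add hadd (hK.volterra hfi), laplace_add hgi (hK.volterra hgi),
    laplace_volterra hK hgi, laplace_volterra hK hfi] at h2
  have hS : 1 + laplace (besselKernel μ) s ≠ 0 := by
    intro h0
    have := congrArg Complex.re h0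
    have hp := re_laplace_besselKernel_nonneg hμ hs
    rw [Complex.add_re, Complex.one_re, Complex.zero_re] at this
    linarith
  rw [reflectionCoeff_eq hμ hs, div_mul_eq_mul_div, eq_div_iff hS]
  linear_combination h2

/-! ### Boundary values of the reflection coefficient on the imaginary axis. -/

theorem tendsto_one_add_sq (μ ω : ℝ) :
    Tendsto (fun σ : ℝ => 1 + (μ : ℂ) ^ 2 * (σ + Complex.I * ω) ^ 2) (𝓝[>] 0)
      (𝓝 ((1 - μ ^ 2 * ω ^ 2 : ℝ) : ℂ)) := by
  have hc : Continuous fun σ : ℝ => 1 + (μ : ℂ) ^ 2 * (σ + Complex.I * ω) ^ 2 := by fun_prop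
  have h := (hc.tendsto 0).mono_left (nhdsWithin_le_nhds (s := Ioi 0))
  convert! h using 2
  push_cast
  rw [zero_add, mul_pow, Complex.I_sq]
  ring

theorem im_one_add_sq (μ ω σ : ℝ) :
    (1 + (μ : ℂ) ^ 2 * (σ + Complex.I * ω) ^ 2).im = 2 * μ ^ 2 * σ * ω := by
  rw [← Complex.ofReal_pow, Complex.add_im, Complex.im_ofReal_mul, pow_two (_ + _), Complex.mul_im]
  simp
  ring

/-- The principal root `√(1 + μ² s²)` has boundary values on the imaginary axis. -/
theorem exists_tendsto_sqrt_one_add_sq {μ : ℝ} (hμ : 0 < μ) (ω : ℝ) :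
    ∃ R : ℂ, Tendsto (fun σ : ℝ => (1 + (μ : ℂ) ^ 2 * (σ + Complex.I * ω) ^ 2) ^ (1 / 2 : ℂ))
      (𝓝[>] 0) (𝓝 R) := by
  have hz := tendsto_one_add_sq μ ω
  rcases lt_trichotomy (1 - μ ^ 2 * ω ^ 2) 0 with h | h | h
  · have hne : ∀ᶠ σ : ℝ in 𝓝[>] 0, 1 + (μ : ℂ) ^ 2 * (σ + Complex.I * ω) ^ 2 ≠ 0 :=
      hz.eventually_ne (by exact_mod_cast h.ne)
    have hlog : ∃ l : ℂ, Tendsto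
        (fun σ : ℝ => Complex.log (1 + (μ : ℂ) ^ 2 * (σ + Complex.I * ω) ^ 2)) (𝓝[>] 0) (𝓝 l) := by
      -- Beyond the cut-off |ω| = 1/μ the limit of 1 + μ²s² lies on the branch cut. Its imaginary
      -- part 2μ²σω has the sign of ω, so the cut is approached from one side and the logarithm has
      -- a limit.
      rcases lt_or_ge ω 0 with hω | hω
      · refine ⟨_, (Complex.tendsto_log_nhdsWithin_im_neg_of_re_neg_of_im_zero (by rwa [Complex.ofReal_re])
          (Complex.ofReal_im _)).comp (tendsto_nhdsWithin_iff.2 ⟨hz, ?_⟩)⟩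
        filter_upwards [self_mem_nhdsWithin] with σ hσ
        refine (im_one_add_sq μ ω σ).trans_lt ?_
        exact mul_neg_of_pos_of_neg (mul_pos (by positivity) hσ) hω
      · refine ⟨_, (Complex.tendsto_log_nhdsWithin_im_nonneg_of_re_neg_of_im_zero
          (by rwa [Complex.ofReal_re]) (Complex.ofReal_im _)).comp (tendsto_nhdsWithin_iff.2 ⟨hz, ?_⟩)⟩
        filter_upwards [self_mem_nhdsWithin] with σ hσ
        refine le_of_le_of_eq ?_ (im_one_add_sq μ ω σ).symm
        have := (mem_Ioi.1 hσ).le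
        positivity
    obtain ⟨l, hl⟩ := hlog
    refine ⟨Complex.exp (l * (1 / 2)), ?_⟩
    refine ((Complex.continuous_exp.tendsto _).comp (hl.mul_const (1 / 2))).congr' ?_
    filter_upwards [hne] with σ hσ
    rw [Complex.cpow_def_of_ne_zero hσ]
    rfl
  · refine ⟨0, ?_⟩
    rw [h, Complex.ofReal_zero] at hz
    have h0 : (1 + (μ : ℂ) ^ 2 * ((0 : ℝ) + Complex.I * ω) ^ 2) = 0 := by
      have : ((1 - μ ^ 2 * ω ^ 2 : ℝ) : ℂ) = 0 := by rw [h, Complex.ofReal_zero]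
      rw [← this]
      push_cast
      rw [zero_add, mul_pow, Complex.I_sq]
      ring
    -- At the cut-off the limit is the branch point 0, where |√z|² = |z| suffices.
    rw [tendsto_zero_iff_norm_tendsto_zero]
    have h2 := (Real.continuous_sqrt.tendsto 0).comp (tendsto_zero_iff_norm_tendsto_zero.1 hz)
    rw [Real.sqrt_zero] at h2
    refine h2.congr fun σ => ?_
    rw [Function.comp_apply, Real.sqrt_eq_iff_mul_self_eq (norm_nonneg _) (norm_nonneg _),
      ← norm_mul, ← pow_two, cpow_half_sq]
  · exact ⟨_, (continuousAt_cpow_const (Or.inl (by rwa [Complex.ofReal_re]))).tendsto.comp hz⟩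

theorem reflectionCoeff_eq_sqrt {μ : ℝ} {s : ℂ}
    (hs : s ≠ 0) (hR : (1 + (μ : ℂ) ^ 2 * s ^ 2) ^ (1 / 2 : ℂ) ≠ 0) :
    reflectionCoeff μ s = ((1 + (μ : ℂ) ^ 2 * s ^ 2) ^ (1 / 2 : ℂ) - 1) /
      ((1 + (μ : ℂ) ^ 2 * s ^ 2) ^ (1 / 2 : ℂ) + 1) := by
  have e0 : halfLineEigenvalue 0 s = s := by simp [halfLineEigenvalue]
  rw [reflectionCoeff, e0, halfLineEigenvalue]
  set R := (1 + (μ : ℂ) ^ 2 * s ^ 2) ^ (1 / 2 : ℂ)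
  have e1 : s - s / R = s / R * (R - 1) := by field_simp
  have e2 : s + s / R = s / R * (R + 1) := by field_simp
  rw [e1, e2, mul_div_mul_left _ _ (div_ne_zero hs hR)]

/-- The reflection coefficient has boundary values on the imaginary axis. -/
theorem exists_tendsto_reflectionCoeff {μ : ℝ} (hμ : 0 < μ) (ω : ℝ) :
    ∃ r : ℂ, Tendsto (fun σ : ℝ => reflectionCoeff μ (σ + Complex.I * ω)) (𝓝[>] 0) (𝓝 r) ∧
      (ω ∈ Ioo (-(1 / μ)) (1 / μ) → r = reflectionCoeff μ (Complex.I * ω)) := by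
  obtain ⟨R, hR⟩ := exists_tendsto_sqrt_one_add_sq hμ ω
  have hre : ∀ σ : ℝ, σ ∈ Ioi (0 : ℝ) → 0 < ((σ : ℂ) + Complex.I * ω).re := fun σ hσ => by
    simpa using hσ
  have hpos : ∀ σ : ℝ, σ ∈ Ioi (0 : ℝ) →
      0 < ((1 + (μ : ℂ) ^ 2 * (σ + Complex.I * ω) ^ 2) ^ (1 / 2 : ℂ)).re := fun σ hσ =>
    re_cpow_half_pos (one_add_sq_mem_slitPlane hμ (hre σ hσ))
  -- The principal root has positive real part for σ > 0, so Re R ≥ 0 in the limit and the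
  -- denominator R + 1 cannot vanish.
  have hRre : 0 ≤ R.re := by
    refine ge_of_tendsto ((Complex.continuous_re.tendsto _).comp hR) ?_
    filter_upwards [self_mem_nhdsWithin] with σ hσ
    exact (hpos σ hσ).le
  have hR1 : R + 1 ≠ 0 := by
    intro h
    have := congrArg Complex.re h
    rw [Complex.add_re, Complex.one_re, Complex.zero_re] at this
    linarith
  refine ⟨(R - 1) / (R + 1), ?_, fun hω => ?_⟩
  · refine ((hR.sub_const 1).div (hR.add_const 1) hR1).congr' ?_
    filter_upwards [self_mem_nhdsWithin] with σ hσ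
    rw [reflectionCoeff_eq_sqrt]
    · rfl
    · intro h
      have := hre σ hσ
      rw [h] at this
      simp at this
    · intro h
      have := hpos σ hσ
      rw [h] at this
      simp at this
  · have hlt : 0 < 1 - μ ^ 2 * ω ^ 2 := by
      have h1 : |μ * ω| < 1 := by
        rw [abs_mul, abs_of_pos hμ]
        have := abs_lt.2 hω
        rwa [lt_div_iff₀' hμ] at this
      have := (sq_lt_one_iff_abs_lt_one (μ * ω)).2 h1
      nlinarith
    have hRe : R = ((1 - μ ^ 2 * ω ^ 2 : ℝ) : ℂ) ^ (1 / 2 : ℂ) :=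
      tendsto_nhds_unique hR ((continuousAt_cpow_const (Or.inl (by rwa [Complex.ofReal_re]))).tendsto.comp
        (tendsto_one_add_sq μ ω))
    have e : 1 + (μ : ℂ) ^ 2 * (Complex.I * ω) ^ 2 = ((1 - μ ^ 2 * ω ^ 2 : ℝ) : ℂ) := by
      push_cast
      rw [mul_pow, Complex.I_sq]
      ring
    -- At ω = 0 the formula for r is 0/0, which evaluates to 0. This agrees with the limit, where R
    -- = 1.
    rcases eq_or_ne ω 0 with rfl | h0
    · rw [hRe]
      simp [reflectionCoeff, halfLineEigenvalue]
    · have hpos' := re_cpow_half_pos (z := ((1 - μ ^ 2 * ω ^ 2 : ℝ) : ℂ)) 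
        (Or.inl (by rwa [Complex.ofReal_re]))
      rw [reflectionCoeff_eq_sqrt, e, hRe]
      · exact mul_ne_zero Complex.I_ne_zero (by exact_mod_cast h0)
      · intro h
        rw [e] at h
        rw [h] at hpos'
        simp at hpos'

/-! ### The causal filter as a Fourier multiplier. -/

theorem laplaceIntegrable_of_memLp {f : ℝ → ℝ}
    (hL : MemLp (fun x => (f x : ℂ)) 2 (volume : Measure ℝ)) {s : ℂ} (hs : 0 < s.re) :
    LaplaceIntegrable f s := by
  have h := (integrable_damp hs hL).integrableOn (s := Ioi 0)
  refine Integrable.mono h ?_ ?_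
  · exact (Continuous.aestronglyMeasurable (by fun_prop)).mul hL.1.restrict
  · filter_upwards [ae_restrict_mem measurableSet_Ioi] with t ht
    rw [damp, norm_mul, norm_mul, Complex.norm_exp, abs_of_pos (mem_Ioi.1 ht)]
    simp only [Complex.norm_real, Real.norm_eq_abs, Real.abs_exp]
    simp

theorem fourier_damp_eq_laplace {f : ℝ → ℝ} (hf0 : ∀ t ≤ 0, f t = 0) (σ ξ : ℝ) :
    𝓕 (damp σ fun x => (f x : ℂ)) ξ = laplace f (σ + Complex.I * (2 * Real.pi * ξ : ℝ)) := by
  rw [Real.fourier_real_eq_integral_exp_smul, laplace, ← integral_indicator measurableSet_Ioi]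
  refine integral_congr_ae (ae_of_all _ fun t => ?_)
  rcases le_or_gt t 0 with ht | ht
  · rw [indicator_of_notMem (by simpa using ht)]
    simp [hf0 t ht, damp]
  · simp only [damp]
    rw [indicator_of_mem (mem_Ioi.2 ht), abs_of_pos ht, smul_eq_mul, ← mul_assoc,
      Complex.ofReal_exp, ← Complex.exp_add]
    congr 2
    push_cast
    ring

/-- For functions vanishing on the negative axis, damped Fourier integrals are Laplace transforms at
σ + jω, on which the filter acts as r(σ + jω). The limit along a common sequence σ → 0⁺ can be taken
because the energy bound puts the filtered function in L². -/
theorem isFilteredBy_reflect {μ : ℝ} (hμ : 0 < μ) {f : ℝ → ℝ} (hf : Continuous f)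
    (hf0 : ∀ t ≤ 0, f t = 0) (hL : MemLp f 2 (volume : Measure ℝ)) {ρ : ℝ → ℂ}
    (hρ : ∀ ω : ℝ, Tendsto (fun σ : ℝ => reflectionCoeff μ (σ + Complex.I * ω)) (𝓝[>] 0)
      (𝓝 (ρ ω))) :
    IsFilteredBy ρ f (reflect μ f) := by
  have hfL : MemLp (fun x => (f x : ℂ)) 2 (volume : Measure ℝ) := hL.ofReal
  have hgL : MemLp (fun x => (reflect μ f x : ℂ)) 2 (volume : Measure ℝ) :=
    (memLp_reflect hμ hf hf0 hL).ofReal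
  refine ⟨hfL, hgL, ?_⟩
  obtain ⟨σ, hσ, hl, h1, h2⟩ := exists_seq_fourier_damp₂ hfL hgL
  have hl' : Tendsto σ atTop (𝓝[>] 0) :=
    tendsto_nhdsWithin_iff.2 ⟨hl, Eventually.of_forall hσ⟩
  filter_upwards [h1, h2] with ξ a b
  refine tendsto_nhds_unique b ((((hρ (2 * Real.pi * ξ)).comp hl').mul a).congr fun n => ?_)
  have hs : 0 < ((σ n : ℂ) + Complex.I * (2 * Real.pi * ξ : ℝ)).re := by simpa using hσ n
  rw [fourier_damp_eq_laplace hf0, fourier_damp_eq_laplace (fun t ht => reflect_eq_zero hf0 ht),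
    laplace_reflect hμ hf hs (laplaceIntegrable_of_memLp hfL hs)
      (laplaceIntegrable_of_memLp hgL hs)]
  rfl

theorem dispersion_zero (κ : ℝ) : dispersion 0 κ = κ := by simp [dispersion]

/-- If the spectrum of `f` lies in an interval, then only the values of the filter on it matter. -/
theorem IsFilteredBy.congr_of_hasSpectrumIn {K : ℝ} {ρ ρ' : ℝ → ℂ} {f g h : ℝ → ℝ}
    (hfg : IsFilteredBy ρ f g) (hh : HasSpectrumIn K h) (hfh : (∀ x, f x = h (-x)) ∨
      ∀ x, f x = -h (-x)) (hρ : ∀ κ ∈ Ioo (-K) K, ρ κ = ρ' κ) : IsFilteredBy ρ' f g := by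
  obtain ⟨hf, hg, hae⟩ := hfg
  obtain ⟨hhL, hh0⟩ := hh
  refine ⟨hf, hg, ?_⟩
  have hr : MemLp (fun x => (h (-x) : ℂ)) 2 (volume : Measure ℝ) :=
    hhL.comp_measurePreserving (Measure.measurePreserving_neg _)
  have h1 := fourier_toLp_comp_neg hhL hr
  have h2 := (Measure.measurePreserving_neg (volume : Measure ℝ)).quasiMeasurePreserving.ae hh0
  have h3 : ∀ᵐ ξ : ℝ, 2 * Real.pi * ξ ∉ Ioo (-K) K →
      (𝓕 hf.toLp : Lp ℂ 2 (volume : Measure ℝ)) ξ = 0 := by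
    have h4 : ∀ᵐ ξ : ℝ, 2 * Real.pi * ξ ∉ Ioo (-K) K →
        (𝓕 hr.toLp : Lp ℂ 2 (volume : Measure ℝ)) ξ = 0 := by
      filter_upwards [h1, h2] with ξ a b hξ
      rw [a]
      -- The band ]-K, K[ is symmetric, so reflecting the function keeps its spectrum in the band.
      refine b fun hm => hξ ⟨?_, ?_⟩
      · linarith [hm.2]
      · linarith [hm.1]
    rcases hfh with hfh | hfh
    · have e : hf.toLp = hr.toLp := MemLp.toLp_congr _ _ (ae_of_all _ fun x => by simp only [hfh])
      rw [e]
      exact h4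
    · have e : hf.toLp = -hr.toLp := by
        rw [← MemLp.toLp_neg]
        exact MemLp.toLp_congr _ _ (ae_of_all _ fun x => by simp [hfh])
      have e2 : (𝓕 hf.toLp : Lp ℂ 2 (volume : Measure ℝ)) = -𝓕 hr.toLp := by
        rw [e, FourierTransform.fourier_neg]
      rw [e2]
      filter_upwards [h4, Lp.coeFn_neg (𝓕 hr.toLp : Lp ℂ 2 (volume : Measure ℝ))] with ξ a b hξ
      rw [b, Pi.neg_apply, a hξ, neg_zero]
  filter_upwards [hae, h3] with ξ a b
  rw [a]
  by_cases hm : 2 * Real.pi * ξ ∈ Ioo (-K) K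
  · rw [hρ _ hm]
  · rw [b hm, mul_zero, mul_zero]

/-! ### Selection of the decaying solution of U'' = L² U. -/

theorem eq_of_hasDerivWithinAt_Ici_zero {E : Type*} [NormedAddCommGroup E] [NormedSpace ℝ E]
    {f : ℝ → E} (h : ∀ x, 0 ≤ x → HasDerivWithinAt f 0 (Ici 0) x) {x : ℝ} (hx : 0 ≤ x) :
    f x = f 0 :=
  constant_of_has_deriv_right_zero (a := 0) (b := x)
    (fun y hy => ((h y hy.1).continuousWithinAt).mono Icc_subset_Ici_self)
    (fun y hy => (h y hy.1).mono (Ici_subset_Ici.2 hy.1)) x ⟨hx, le_rfl⟩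

theorem commute_smul_one_add_sq {A : Type*} [NormedRing A] [NormedAlgebra ℝ A] {L J : A}
    (h : Commute L J) (c : ℝ) : Commute L (c • 1 + J ^ 2) :=
  ((Commute.one_right L).smul_right _).add_right (h.pow_right 2)

section AbstractODE

variable {E : Type*} [NormedAddCommGroup E] [NormedSpace ℝ E] [CompleteSpace E]

theorem exp_smul_apply_eq_of_hasDerivWithinAt {L : E →L[ℝ] E} {W : ℝ → E}
    (hW : ∀ x, 0 ≤ x → HasDerivWithinAt W (L (W x)) (Ici 0) x) {x : ℝ} (hx : 0 ≤ x) :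
    NormedSpace.exp (x • -L) (W x) = W 0 := by
  have hd : ∀ y, 0 ≤ y → HasDerivWithinAt (fun y => NormedSpace.exp (y • -L) (W y)) 0 (Ici 0) y := by
    intro y hy
    have h1 := (hasDerivAt_exp_smul_const (𝕂 := ℝ) (-L) y).hasDerivWithinAt (s := Ici 0)
    have h2 := h1.clm_apply (hW y hy)
    convert! h2 using 1
    rw [mul_apply_eq_comp, neg_apply, map_neg, neg_add_cancel]
  have h := eq_of_hasDerivWithinAt_Ici_zero hd hx
  rw [h, zero_smul, NormedSpace.exp_zero]
  rfl

/-- A solution of `U'' = L² U` on the half-line which does not grow along a sequence, where `L`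
generates an exponentially decaying semigroup `exp (-x L)`, satisfies `U' (0) = -L U (0)`. -/
theorem apply_add_eq_zero_of_frequently_le {L M J : E →L[ℝ] E} {U U₁ : ℝ → E}
    (hU : ∀ x, 0 ≤ x → HasDerivWithinAt U (U₁ x) (Ici 0) x)
    (hU₁ : ∀ x, 0 ≤ x → HasDerivWithinAt U₁ (L (L (U x))) (Ici 0) x)
    (hLM : L * M = 1) (hML : Commute L M) (hLJ : Commute L J)
    {C a : ℝ} (ha : 0 < a)
    (hexp : ∀ x : ℝ, 0 ≤ x → ‖NormedSpace.exp (-x • L)‖ ≤ C * Real.exp (-(x / a)))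
    {K : ℝ} (hK : ∃ᶠ x in atTop, ‖J (U x)‖ ≤ K) :
    J (U₁ 0 + L (U 0)) = 0 := by
  -- The growing mode: W' = L W.
  set W : ℝ → E := fun x => U₁ x + L (U x) with hWdef
  have hLMa : ∀ v, L (M v) = v := fun v => DFunLike.congr_fun hLM v
  have hMLa : ∀ v, M (L v) = v := fun v => (DFunLike.congr_fun hML.eq v).symm.trans (hLMa v)
  have hJLa : ∀ v, J (L v) = L (J v) := fun v => (DFunLike.congr_fun hLJ.eq v).symm
  have hW : ∀ x, 0 ≤ x → HasDerivWithinAt W (L (W x)) (Ici 0) x := by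
    intro x hx
    have h := (hU₁ x hx).add (L.hasFDerivAt.comp_hasDerivWithinAt x (hU x hx))
    convert! h using 1
    simp only [hWdef, map_add]
    exact add_comm _ _
  -- The decaying mode: as M inverts L, V = U - M U' and V' = -L V, while 2U = V + M W.
  set V : ℝ → E := fun x => U x + U x - M (W x) with hVdef
  have hV : ∀ x, 0 ≤ x → HasDerivWithinAt V ((-L) (V x)) (Ici 0) x := by
    intro x hx
    have h := ((hU x hx).add (hU x hx)).sub (M.hasFDerivAt.comp_hasDerivWithinAt x (hW x hx))
    convert! h using 1
    simp only [hVdef, neg_apply, map_sub, map_add, hLMa, hMLa, hWdef]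
    abel
  have hUV : ∀ x, U x + U x = V x + M (W x) := fun x => by simp [hVdef]
  have hW0 : W 0 = U₁ 0 + L (U 0) := rfl
  clear_value W V
  have eW : ∀ x : ℝ, 0 ≤ x → NormedSpace.exp (-x • L) (W x) = W 0 := fun x hx => by
    have := exp_smul_apply_eq_of_hasDerivWithinAt hW hx
    rwa [smul_neg, ← neg_smul] at this
  have eV : ∀ x : ℝ, 0 ≤ x → V x = NormedSpace.exp (-x • L) (V 0) := fun x hx => by
    have h1 := exp_smul_apply_eq_of_hasDerivWithinAt hV hx
    have h2 := exp_mul_exp_neg (-x • L)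
    rw [neg_neg] at h1
    rw [← neg_smul, neg_neg] at h2
    rw [← h1]
    exact (DFunLike.congr_fun h2 (V x)).symm
  have cM : ∀ (x : ℝ) v, NormedSpace.exp (-x • L) (M v) = M (NormedSpace.exp (-x • L) v) :=
    fun x v => DFunLike.congr_fun (((hML.symm).smul_right (-x)).exp_right).eq.symm v
  have cJ : ∀ (x : ℝ) v, NormedSpace.exp (-x • L) (J v) = J (NormedSpace.exp (-x • L) v) :=
    fun x v => DFunLike.congr_fun (((hLJ.symm).smul_right (-x)).exp_right).eq.symm v
  -- Applying exp(-xL) J to 2U = V + M W turns the growing mode into the constant J M W(0). All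
  -- other terms decay along points where J U(x) is bounded.
  have key : ∀ x : ℝ, 0 ≤ x → J (M (W 0)) =
      NormedSpace.exp (-x • L) (J (U x)) + NormedSpace.exp (-x • L) (J (U x)) -
      NormedSpace.exp (-x • L) (NormedSpace.exp (-x • L) (J (V 0))) := by
    intro x hx
    rw [← map_add, ← map_add, hUV, map_add, map_add, cJ x (M (W x)), cM, eW x hx, cJ x (V 0),
      ← eV x hx]
    abel
  have hzero : ‖J (M (W 0))‖ ≤ 0 := by
    have hlim : Tendsto (fun x : ℝ => 2 * (C * Real.exp (-(x / a)) * K) +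
        C * Real.exp (-(x / a)) * (C * Real.exp (-(x / a)) * ‖J (V 0)‖)) atTop
        (𝓝 (2 * (C * 0 * K) + C * 0 * (C * 0 * ‖J (V 0)‖))) := by
      have h0 : Tendsto (fun x : ℝ => Real.exp (-(x / a))) atTop (𝓝 0) :=
        Real.tendsto_exp_neg_atTop_nhds_zero.comp (tendsto_id.atTop_div_const ha)
      have h1 := h0.const_mul C
      exact ((h1.mul_const K).const_mul 2).add (h1.mul (h1.mul_const _))
    simp only [mul_zero, zero_mul, add_zero] at hlim
    by_contra! hpos
    have hev := (hlim.eventually_lt_const hpos).and (eventually_ge_atTop 0)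
    obtain ⟨x, hx, hlt, hx0⟩ := (hK.and_eventually hev).exists
    have hb := hexp x hx0
    have hCn : 0 ≤ C * Real.exp (-(x / a)) := (norm_nonneg _).trans hb
    have hle : ‖J (M (W 0))‖ ≤ 2 * (C * Real.exp (-(x / a)) * K) +
        C * Real.exp (-(x / a)) * (C * Real.exp (-(x / a)) * ‖J (V 0)‖) := by
      rw [key x hx0]
      refine (norm_sub_le _ _).trans (add_le_add ?_ ?_)
      · have h1 := (ContinuousLinearMap.le_opNorm (NormedSpace.exp (-x • L)) (J (U x))).trans
          (mul_le_mul hb hx (norm_nonneg _) hCn)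
        rw [two_mul]
        exact (norm_add_le _ _).trans (add_le_add h1 h1)
      · refine (ContinuousLinearMap.le_opNorm _ _).trans
          (mul_le_mul hb ?_ (norm_nonneg _) hCn)
        exact (ContinuousLinearMap.le_opNorm _ _).trans
          (mul_le_mul_of_nonneg_right hb (norm_nonneg _))
    exact absurd hlt (not_lt.2 hle)
  have h0 : J (M (W 0)) = 0 := norm_le_zero_iff.1 hzero
  have h1 := congrArg L h0
  rw [← hJLa, hLMa, map_zero] at h1
  rwa [hW0] at h1

end AbstractODE

/-- Only J U(x), not U(x), is controlled by an L² bound in time, so the boundary relation is first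
obtained after applying J; injectivity then removes J. -/
theorem primOp_injective {T : ℝ} (hT : 0 < T) {f : C(Icc (0 : ℝ) T, ℝ)}
    (h : primOp hT.le f = 0) : f = 0 := by
  ext t
  have hc := f.continuous.Icc_extend' (h := hT.le)
  have h1 : HasDerivWithinAt (primitive (IccExtend hT.le f)) (IccExtend hT.le f t) (Icc 0 T) t :=
    (hc.integral_hasStrictDerivAt 0 _).hasDerivAt.hasDerivWithinAt
  have h2 : HasDerivWithinAt (primitive (IccExtend hT.le f)) 0 (Icc 0 T) t := by
    refine (hasDerivWithinAt_const (t : ℝ) (Icc 0 T) (0 : ℝ)).congr (fun s hs => ?_) ?_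
    · exact DFunLike.congr_fun h ⟨s, hs⟩
    · exact DFunLike.congr_fun h t
  have h3 := (uniqueDiffOn_Icc hT t t.2).eq_deriv _ h1 h2
  rwa [IccExtend_val] at h3

/-- A curve in `C([0, T])` with `U = (μ² + J²) U''`, and which does not grow along a sequence,
satisfies `U' (0) = -(μ² + J²) ^ (-1 / 2) U (0)`. -/
theorem deriv_eq_neg_invSqrtOp {μ T : ℝ} (hμ : 0 < μ) (hT : 0 < T)
    {U U₁ U₂ : ℝ → C(Icc (0 : ℝ) T, ℝ)}
    (hU : ∀ x, 0 ≤ x → HasDerivWithinAt U (U₁ x) (Ici 0) x)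
    (hU₁ : ∀ x, 0 ≤ x → HasDerivWithinAt U₁ (U₂ x) (Ici 0) x)
    (h : ∀ x, 0 ≤ x → U x = μ ^ 2 • U₂ x + primOp hT.le (primOp hT.le (U₂ x)))
    {K : ℝ} (hK : ∃ᶠ x in atTop, ‖primOp hT.le (U x)‖ ≤ K) :
    U₁ 0 = -invSqrtOp μ (primOp hT.le) (U 0) := by
  set J := primOp hT.le with hJ
  set L := invSqrtOp μ J with hL
  have hJp := norm_primOp_pow_le hT.le
  have hLJ : Commute L J := (commute_invSqrtOp (J := J) μ).symm
  set P : C(Icc (0 : ℝ) T, ℝ) →L[ℝ] C(Icc (0 : ℝ) T, ℝ) := μ ^ 2 • 1 + J ^ 2 with hP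
  have hLLP : L * L * P = 1 := invSqrtOp_mul_self_mul (J := J) hμ hJp
  have hLP : Commute L P := commute_smul_one_add_sq (L := L) (J := J) hLJ (μ ^ 2)
  have hPa : ∀ v, P v = μ ^ 2 • v + J (J v) := fun v => by
    rw [hP, pow_two J]
    rfl
  have hU₂ : ∀ x, 0 ≤ x → L (L (U x)) = U₂ x := fun x hx => by
    rw [h x hx, ← hPa]
    exact DFunLike.congr_fun hLLP (U₂ x)
  obtain ⟨C, hC⟩ := exists_norm_exp_neg_smul_invSqrtOp_le (J := J) hμ hJp hT.le
    ContinuousLinearMap.norm_id_le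
  -- The inverse of L is L P, because L² P = 1.
  have h0 := apply_add_eq_zero_of_frequently_le (L := L) (M := L * P) (J := J) hU
    (fun x hx => by rw [hU₂ x hx]; exact hU₁ x hx) (by rw [← mul_assoc, hLLP])
    ((Commute.refl L).mul_right hLP) hLJ (a := 2 * μ) (by positivity) hC hK
  exact eq_neg_of_add_eq_zero_left (primOp_injective hT h0)

/-! ### Partial derivatives up to the boundary, and curves in C([0, T]). -/

section Partials

variable {X : Set ℝ} {T : ℝ} {f : ℝ → ℝ → ℝ}

theorem IsC1On.hasFDerivWithinAt (hf : IsC1On X T f) {x t : ℝ} (hx : x ∈ X) (ht : t ∈ Icc 0 T) :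
    HasFDerivWithinAt (Function.uncurry f)
      (fderivWithin ℝ (Function.uncurry f) (X ×ˢ Icc 0 T) (x, t)) (X ×ˢ Icc 0 T) (x, t) :=
  ((hf.differentiableOn one_ne_zero) (x, t) ⟨hx, ht⟩).hasFDerivWithinAt

theorem IsC1On.hasDerivWithinAt_time_aux (hf : IsC1On X T f) {x t : ℝ} (hx : x ∈ X)
    (ht : t ∈ Icc 0 T) : HasDerivWithinAt (fun τ => f x τ)
      (fderivWithin ℝ (Function.uncurry f) (X ×ˢ Icc 0 T) (x, t) (0, 1)) (Icc 0 T) t := by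
  have h := (hf.hasFDerivWithinAt hx ht).comp_hasDerivWithinAt (f := fun τ => (x, τ)) t
    (((hasDerivAt_const t x).prodMk (hasDerivAt_id t)).hasDerivWithinAt) (fun τ hτ => ⟨hx, hτ⟩)
  exact h

theorem IsC1On.hasDerivWithinAt_space_aux (hf : IsC1On X T f) {x t : ℝ} (hx : x ∈ X)
    (ht : t ∈ Icc 0 T) : HasDerivWithinAt (fun y => f y t)
      (fderivWithin ℝ (Function.uncurry f) (X ×ˢ Icc 0 T) (x, t) (1, 0)) X x := by
  have h := (hf.hasFDerivWithinAt hx ht).comp_hasDerivWithinAt (f := fun y => (y, t)) x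
    (((hasDerivAt_id x).prodMk (hasDerivAt_const x t)).hasDerivWithinAt) (fun y hy => ⟨hy, ht⟩)
  exact h

theorem IsC1On.dTime_eq (hf : IsC1On X T f) (hT : 0 < T) {x t : ℝ} (hx : x ∈ X)
    (ht : t ∈ Icc 0 T) :
    dTime T f x t = fderivWithin ℝ (Function.uncurry f) (X ×ˢ Icc 0 T) (x, t) (0, 1) :=
  (hf.hasDerivWithinAt_time_aux hx ht).derivWithin (uniqueDiffOn_Icc hT t ht)

theorem IsC1On.dSpace_eq (hf : IsC1On X T f) (hX : UniqueDiffOn ℝ X) {x t : ℝ} (hx : x ∈ X)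
    (ht : t ∈ Icc 0 T) :
    dSpace X f x t = fderivWithin ℝ (Function.uncurry f) (X ×ˢ Icc 0 T) (x, t) (1, 0) :=
  (hf.hasDerivWithinAt_space_aux hx ht).derivWithin (hX x hx)

theorem IsC1On.hasDerivWithinAt_time (hf : IsC1On X T f) (hT : 0 < T) {x t : ℝ} (hx : x ∈ X)
    (ht : t ∈ Icc 0 T) : HasDerivWithinAt (fun τ => f x τ) (dTime T f x t) (Icc 0 T) t := by
  rw [hf.dTime_eq hT hx ht]
  exact hf.hasDerivWithinAt_time_aux hx ht

theorem IsC1On.hasDerivWithinAt_space (hf : IsC1On X T f) (hX : UniqueDiffOn ℝ X) {x t : ℝ}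
    (hx : x ∈ X) (ht : t ∈ Icc 0 T) : HasDerivWithinAt (fun y => f y t) (dSpace X f x t) X x := by
  rw [hf.dSpace_eq hX hx ht]
  exact hf.hasDerivWithinAt_space_aux hx ht

theorem IsC1On.continuousOn_fderivWithin_apply (hf : IsC1On X T f) (hX : UniqueDiffOn ℝ X)
    (hT : 0 < T) (v : ℝ × ℝ) : ContinuousOn
      (fun p => fderivWithin ℝ (Function.uncurry f) (X ×ˢ Icc 0 T) p v) (X ×ˢ Icc 0 T) :=
  (hf.continuousOn_fderivWithin (hX.prod (uniqueDiffOn_Icc hT)) le_rfl).clm_apply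
    continuousOn_const

theorem IsC1On.continuousOn_dTime (hf : IsC1On X T f) (hX : UniqueDiffOn ℝ X) (hT : 0 < T) :
    ContinuousOn (Function.uncurry (dTime T f)) (X ×ˢ Icc 0 T) :=
  (hf.continuousOn_fderivWithin_apply hX hT (0, 1)).congr fun _ hp => hf.dTime_eq hT hp.1 hp.2

theorem IsC1On.continuousOn_dSpace (hf : IsC1On X T f) (hX : UniqueDiffOn ℝ X) (hT : 0 < T) :
    ContinuousOn (Function.uncurry (dSpace X f)) (X ×ˢ Icc 0 T) :=
  (hf.continuousOn_fderivWithin_apply hX hT (1, 0)).congr fun _ hp => hf.dSpace_eq hX hp.1 hp.2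

theorem continuousOn_slice {g : ℝ → ℝ → ℝ} (hg : ContinuousOn (Function.uncurry g) (X ×ˢ Icc 0 T))
    {x : ℝ} (hx : x ∈ X) : ContinuousOn (g x) (Icc 0 T) :=
  hg.comp (f := fun t => (x, t)) (by fun_prop) fun t ht => ⟨hx, ht⟩

theorem integral_eq_sub_of_hasDerivWithinAt_Icc {f f' : ℝ → ℝ} {a b T : ℝ}
    (hf : ∀ t ∈ Icc a T, HasDerivWithinAt f (f' t) (Icc a T) t) (hf' : ContinuousOn f' (Icc a T))
    (hb : b ∈ Icc a T) : ∫ s in a..b, f' s = f b - f a := by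
  have hsub : Icc a b ⊆ Icc a T := Icc_subset_Icc_right hb.2
  refine intervalIntegral.integral_eq_sub_of_hasDeriv_right_of_le hb.1
    (fun t ht => ((hf t (hsub ht)).continuousWithinAt).mono hsub) (fun t ht => ?_)
    ((hf'.mono hsub).intervalIntegrable_of_Icc hb.1)
  have h := hf t (hsub (Ioo_subset_Icc_self ht))
  exact (h.hasDerivAt (Icc_mem_nhds ht.1 (ht.2.trans_le hb.2))).hasDerivWithinAt

theorem IsC1On.integral_dTime (hf : IsC1On X T f) (hX : UniqueDiffOn ℝ X) (hT : 0 < T) {x t : ℝ}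
    (hx : x ∈ X) (ht : t ∈ Icc 0 T) : ∫ s in (0 : ℝ)..t, dTime T f x s = f x t - f x 0 :=
  integral_eq_sub_of_hasDerivWithinAt_Icc (fun _ hs => hf.hasDerivWithinAt_time hT hx hs)
    (continuousOn_slice (hf.continuousOn_dTime hX hT) hx) ht

end Partials

/-- A function which is continuous on `[0, ∞) × [0, T]` as a curve in `C([0, T])`. -/
def curveOf {T : ℝ} {g : ℝ → ℝ → ℝ} (hg : ContinuousOn (Function.uncurry g) (Ici 0 ×ˢ Icc 0 T)) :
    C(ℝ, C(Icc (0 : ℝ) T, ℝ)) :=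
  ContinuousMap.curry ⟨fun p : ℝ × Icc (0 : ℝ) T => g (max p.1 0) p.2,
    hg.comp_continuous (f := fun p : ℝ × Icc (0 : ℝ) T => (max p.1 0, (p.2 : ℝ))) (by fun_prop)
      fun p => ⟨mem_Ici.2 (le_max_right _ _), p.2.2⟩⟩

theorem curveOf_apply {T : ℝ} {g : ℝ → ℝ → ℝ}
    (hg : ContinuousOn (Function.uncurry g) (Ici 0 ×ˢ Icc 0 T)) {x : ℝ} (hx : 0 ≤ x)
    (t : Icc (0 : ℝ) T) : curveOf hg x t = g x t := by
  change g (max x 0) t = g x t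
  rw [max_eq_left hx]

/-- Pointwise derivatives in x become derivatives in the sup norm over t: the curve is the integral
of the curve of its partial derivatives, which is continuous into C([0, T]). -/
theorem hasDerivWithinAt_curveOf {T : ℝ} {g g' : ℝ → ℝ → ℝ}
    (hg : ContinuousOn (Function.uncurry g) (Ici 0 ×ˢ Icc 0 T))
    (hg' : ContinuousOn (Function.uncurry g') (Ici 0 ×ˢ Icc 0 T))
    (hd : ∀ x ∈ Ici (0 : ℝ), ∀ t ∈ Icc 0 T, HasDerivWithinAt (fun y => g y t) (g' x t) (Ici 0) x)
    {x : ℝ} (hx : 0 ≤ x) : HasDerivWithinAt (curveOf hg) (curveOf hg' x) (Ici 0) x := by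
  have e : ∀ y ∈ Ici (0 : ℝ), curveOf hg y = curveOf hg 0 + ∫ z in (0 : ℝ)..y, curveOf hg' z := by
    intro y hy
    ext t
    have hcomm := (ContinuousMap.evalCLM ℝ t).intervalIntegral_comp_comm
      ((curveOf hg').continuous.intervalIntegrable (μ := volume) 0 y)
    have h1 : (∫ z in (0 : ℝ)..y, curveOf hg' z) t = ∫ z in (0 : ℝ)..y, curveOf hg' z t :=
      hcomm.symm
    have h2 : ∫ z in (0 : ℝ)..y, curveOf hg' z t = ∫ z in (0 : ℝ)..y, g' z t := by
      refine intervalIntegral.integral_congr fun z hz => ?_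
      rw [uIcc_of_le hy] at hz
      exact curveOf_apply hg' hz.1 t
    have h3 : ∫ z in (0 : ℝ)..y, g' z t = g y t - g 0 t := by
      refine integral_eq_sub_of_hasDerivWithinAt_Icc (T := y)
        (fun z hz => (hd z hz.1 t t.2).mono Icc_subset_Ici_self) ?_ ⟨hy, le_rfl⟩
      exact hg'.comp (f := fun z => (z, (t : ℝ))) (by fun_prop) fun z hz => ⟨hz.1, t.2⟩
    rw [ContinuousMap.add_apply, h1, h2, h3, curveOf_apply hg hy, curveOf_apply hg le_rfl]
    ring
  have h := ((curveOf hg').continuous.integral_hasStrictDerivAt 0 x).hasDerivAt.const_add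
    (curveOf hg 0)
  exact h.hasDerivWithinAt.congr e (e x hx)

/-! ### The Boussinesq system on the half-line. -/

theorem integral_abs_le_of_integral_sq_le {T : ℝ} (hT : 0 ≤ T) {f : ℝ → ℝ}
    (hf : ContinuousOn f (Icc 0 T)) (h : ∫ s in Ioo 0 T, ‖f s‖ ^ 2 ≤ 1) {t : ℝ} (ht : t ∈ Icc 0 T) :
    |∫ s in (0 : ℝ)..t, f s| ≤ (T + 1) / 2 := by
  have hi : IntegrableOn (fun s => ‖f s‖ ^ 2) (Ioo 0 T) :=
    ((hf.norm.pow 2).integrableOn_Icc).mono_set Ioo_subset_Icc_self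
  have hi1 : IntegrableOn (fun s => ‖f s‖) (Ioo 0 T) :=
    (hf.norm.integrableOn_Icc).mono_set Ioo_subset_Icc_self
  have hic : IntegrableOn (fun _ : ℝ => (1 : ℝ)) (Ioo 0 T) := integrableOn_const (by simp)
  have h1 : |∫ s in (0 : ℝ)..t, f s| ≤ ∫ s in Ioo 0 t, ‖f s‖ := by
    rw [intervalIntegral.integral_of_le ht.1, integral_Ioc_eq_integral_Ioo]
    exact norm_integral_le_integral_norm (μ := volume.restrict (Ioo 0 t)) f
  have h2 : ∫ s in Ioo 0 t, ‖f s‖ ≤ ∫ s in Ioo 0 T, ‖f s‖ :=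
    setIntegral_mono_set hi1 (ae_of_all _ fun s => norm_nonneg _)
      (Ioo_subset_Ioo_right ht.2).eventuallyLE
  have h3 : ∫ s in Ioo 0 T, ‖f s‖ ≤ ∫ s in Ioo 0 T, (1 + ‖f s‖ ^ 2) / 2 := by
    refine setIntegral_mono hi1 ((Integrable.add hic hi).div_const 2) fun s => ?_
    simp only
    nlinarith [sq_nonneg (‖f s‖ - 1)]
  have h4 : ∫ s in Ioo 0 T, (1 + ‖f s‖ ^ 2) / 2 = (T + ∫ s in Ioo 0 T, ‖f s‖ ^ 2) / 2 := by
    rw [integral_div, integral_add hic hi]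
    simp [hT]
  linarith

/-- By Fubini the energy of the time slices is integrable in x over a half-line of infinite length,
so it cannot eventually stay above 1. -/
theorem frequently_integral_sq_le {T : ℝ} {f : ℝ → ℝ → ℝ}
    (hf : MemLp (Function.uncurry f) 2 (volume.restrict (Ici 0 ×ˢ Ioo 0 T))) :
    ∃ᶠ x in atTop, ∫ s in Ioo 0 T, ‖f x s‖ ^ 2 ≤ 1 := by
  have hi : Integrable (fun p : ℝ × ℝ => ‖Function.uncurry f p‖ ^ 2)
      ((volume.restrict (Ici 0)).prod (volume.restrict (Ioo 0 T))) := by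
    rw [Measure.prod_restrict, ← Measure.volume_eq_prod]
    exact (memLp_two_iff_integrable_sq_norm hf.1).1 hf
  have hx : IntegrableOn (fun x => ∫ s in Ioo 0 T, ‖f x s‖ ^ 2) (Ici 0) := hi.integral_prod_left
  intro hev
  obtain ⟨a, ha⟩ := eventually_atTop.1 hev
  have h1 : IntegrableOn (fun _ : ℝ => (1 : ℝ)) (Ici (max a 0)) := by
    refine Integrable.mono (hx.mono_set (Ici_subset_Ici.2 (le_max_right a 0)))
      aestronglyMeasurable_const ?_
    filter_upwards [ae_restrict_mem measurableSet_Ici] with x hx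
    have := ha x ((le_max_left _ _).trans hx)
    rw [norm_one, Real.norm_eq_abs]
    exact (not_le.1 this).le.trans (le_abs_self _)
  rw [integrableOn_const_iff] at h1
  simp at h1

/-- The boundary values of a solution of the Boussinesq system on the half-line with zero initial
datum satisfy `∫₀ᵗ ∂ₓu (0, s) ds = -(B u(0, ·)) (t)`, where `B` has the symbol `1 / √(1 + μ² s²)`. -/
theorem IsBoussinesqSolution.integral_dSpace_eq {μ T : ℝ} (hμ : 0 < μ) (hT : 0 < T)
    {η₀ u₀ : ℝ → ℝ} {η u : ℝ → ℝ → ℝ} (h : IsBoussinesqSolution μ (Ici 0) T η₀ u₀ η u)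
    (hη₀ : ∀ x, 0 ≤ x → η₀ x = 0) (hu₀ : ∀ x, 0 ≤ x → u₀ x = 0)
    {v : C(Icc (0 : ℝ) T, ℝ)} (hv : ∀ t, v t = u 0 t) (t : Icc (0 : ℝ) T) :
    ∫ s in (0 : ℝ)..t, dSpace (Ici 0) u 0 s = -besselOp μ hT.le v t := by
  have hX : UniqueDiffOn ℝ (Ici (0 : ℝ)) := uniqueDiffOn_Ici 0
  have cη := h.smooth_eta.continuousOn
  have cηx := h.smooth_eta.continuousOn_dSpace hX hT
  have cu := h.smooth_u.continuousOn
  have cu₁ := h.smooth_ux.continuousOn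
  have cu₂ := h.smooth_uxx.continuousOn
  set J := primOp hT.le with hJ
  have hJc : ∀ {g : ℝ → ℝ → ℝ} (hg : ContinuousOn (Function.uncurry g) (Ici 0 ×ˢ Icc 0 T)) {x : ℝ}
      (_ : 0 ≤ x) (t : Icc (0 : ℝ) T), J (curveOf hg x) t = ∫ s in (0 : ℝ)..t, g x s := by
    intro g hg x hx t
    refine intervalIntegral.integral_congr fun s hs => ?_
    rw [uIcc_of_le t.2.1] at hs
    have hs' : s ∈ Icc 0 T := ⟨hs.1, hs.2.trans t.2.2⟩
    rw [IccExtend_of_mem hT.le _ hs', curveOf_apply hg hx]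
  have dU : ∀ x, 0 ≤ x → HasDerivWithinAt (curveOf cu) (curveOf cu₁ x) (Ici 0) x := fun x hx =>
    hasDerivWithinAt_curveOf cu cu₁
      (fun x hx t ht => h.smooth_u.hasDerivWithinAt_space hX hx ht) hx
  have dU₁ : ∀ x, 0 ≤ x → HasDerivWithinAt (curveOf cu₁) (curveOf cu₂ x) (Ici 0) x := fun x hx =>
    hasDerivWithinAt_curveOf cu₁ cu₂
      (fun x hx t ht => h.smooth_ux.hasDerivWithinAt_space hX hx ht) hx
  have dH : ∀ x, 0 ≤ x → HasDerivWithinAt (curveOf cη) (curveOf cηx x) (Ici 0) x := fun x hx =>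
    hasDerivWithinAt_curveOf cη cηx
      (fun x hx t ht => h.smooth_eta.hasDerivWithinAt_space hX hx ht) hx
  -- Conservation of mass integrated in time, with zero initial elevation.
  have eH : ∀ x ∈ Ici (0 : ℝ), curveOf cη x = -J (curveOf cu₁ x) := by
    intro x hx
    ext t
    have h1 := h.smooth_eta.integral_dTime hX hT hx t.2
    rw [h.initial_eta x hx, hη₀ x hx, sub_zero] at h1
    rw [ContinuousMap.neg_apply, hJc cu₁ hx, curveOf_apply cη hx, ← h1,
      ← intervalIntegral.integral_neg]
    refine intervalIntegral.integral_congr fun s hs => ?_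
    rw [uIcc_of_le t.2.1] at hs
    exact eq_neg_of_add_eq_zero_left (h.mass x hx s ⟨hs.1, hs.2.trans t.2.2⟩)
  -- Differentiating the identity between curves in x bypasses mixed partial derivatives of η.
  have eHx : ∀ x, 0 ≤ x → curveOf cηx x = -J (curveOf cu₂ x) := by
    intro x hx
    have h1 := (J.hasFDerivAt.comp_hasDerivWithinAt x (dU₁ x hx)).neg
    have h2 := h1.congr eH (eH x hx)
    exact (hX x hx).eq_deriv _ (dH x hx) h2
  have hu₂0 : ∀ x, 0 ≤ x → dSpace (Ici 0) (dSpace (Ici 0) u) x 0 = 0 := by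
    have h0 : ∀ x ∈ Ici (0 : ℝ), u x 0 = 0 := fun x hx => by rw [h.initial_u x hx, hu₀ x hx]
    have h1 : ∀ x ∈ Ici (0 : ℝ), dSpace (Ici 0) u x 0 = 0 := fun x hx => by
      rw [dSpace, derivWithin_congr (f := fun _ => (0 : ℝ)) h0 (h0 x hx)]
      simp
    intro x hx
    rw [dSpace, derivWithin_congr (f := fun _ => (0 : ℝ)) h1 (h1 x hx)]
    simp
  -- The momentum equation integrated in time reads u - μ² ∂ₓ²u = -J ∂ₓη, and the right side is J²
  -- ∂ₓ²u.
  have hode : ∀ x, 0 ≤ x → curveOf cu x =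
      μ ^ 2 • curveOf cu₂ x + J (J (curveOf cu₂ x)) := by
    intro x hx
    have e : J (J (curveOf cu₂ x)) = -J (curveOf cηx x) := by rw [eHx x hx, map_neg, neg_neg]
    rw [e]
    ext t
    rw [ContinuousMap.add_apply, ContinuousMap.smul_apply, ContinuousMap.neg_apply, hJc cηx hx,
      curveOf_apply cu hx, curveOf_apply cu₂ hx, smul_eq_mul]
    have h1 := h.smooth_u.integral_dTime hX hT hx t.2
    have h2 := h.smooth_uxx.integral_dTime hX hT hx t.2
    rw [h.initial_u x hx, hu₀ x hx, sub_zero] at h1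
    rw [hu₂0 x hx, sub_zero] at h2
    have hsub : uIcc 0 (t : ℝ) ⊆ Icc 0 T := by
      rw [uIcc_of_le t.2.1]
      exact Icc_subset_Icc_right t.2.2
    have i1 := ((continuousOn_slice (h.smooth_u.continuousOn_dTime hX hT) hx).mono
      hsub).intervalIntegrable (μ := volume)
    have i2 := ((continuousOn_slice (h.smooth_uxx.continuousOn_dTime hX hT) hx).mono
      hsub).intervalIntegrable (μ := volume)
    rw [← h1, ← h2, ← intervalIntegral.integral_const_mul, ← sub_eq_iff_eq_add',
      ← intervalIntegral.integral_sub i1 (i2.const_mul _), ← intervalIntegral.integral_neg]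
    refine intervalIntegral.integral_congr fun s hs => ?_
    have := h.momentum x hx s (hsub hs)
    linarith
  have hK : ∃ᶠ x in atTop, ‖J (curveOf cu x)‖ ≤ (T + 1) / 2 := by
    refine ((frequently_integral_sq_le h.memLp_u).and_eventually
      (eventually_ge_atTop 0)).mono fun x ⟨h1, hx⟩ => ?_
    refine (ContinuousMap.norm_le _ (by positivity)).2 fun t => ?_
    rw [hJc cu hx]
    exact integral_abs_le_of_integral_sq_le hT.le (continuousOn_slice cu hx) h1 t.2
  have hfin := deriv_eq_neg_invSqrtOp hμ hT dU dU₁ hode hK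
  have hv' : curveOf cu 0 = v := by
    ext t
    rw [curveOf_apply cu le_rfl, hv]
  rw [← hJc cu₁ le_rfl, hfin, map_neg, hv']
  rfl

/-! ### The Saint-Venant system: characteristics and d'Alembert's formula. -/

/-- The Riemann invariants of the Saint-Venant system are constant along the characteristics. -/
theorem IsSaintVenantSolution.eq_along_characteristic {X : Set ℝ} {T : ℝ} {η₀ u₀ : ℝ → ℝ}
    {η u : ℝ → ℝ → ℝ} (h : IsSaintVenantSolution X T η₀ u₀ η u) (hX : UniqueDiffOn ℝ X)
    (hXc : X.OrdConnected) (hT : 0 < T) {c : ℝ} (hc : c * c = 1) {x₀ x₁ t₀ t₁ : ℝ} (hx₀ : x₀ ∈ X)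
    (hx₁ : x₁ ∈ X) (ht₀ : 0 ≤ t₀) (ht : t₀ ≤ t₁) (ht₁ : t₁ ≤ T) (hx : x₁ - x₀ = c * (t₁ - t₀)) :
    η x₁ t₁ + c * u x₁ t₁ = η x₀ t₀ + c * u x₀ t₀ := by
  set γ : ℝ → ℝ × ℝ := fun s => (x₀ + c * (s - t₀), s) with hγ
  have hmem : MapsTo γ (Icc t₀ t₁) (X ×ˢ Icc 0 T) := by
    intro s hs
    refine ⟨hXc.uIcc_subset hx₀ hx₁ (mem_uIcc.2 ?_), ht₀.trans hs.1, hs.2.trans ht₁⟩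
    simp only [hγ]
    rcases le_total 0 c with h0 | h0
    · left
      constructor <;> nlinarith [mul_nonneg h0 (sub_nonneg.2 hs.1), mul_nonneg h0 (sub_nonneg.2 hs.2)]
    · right
      constructor <;> nlinarith [mul_nonneg (neg_nonneg.2 h0) (sub_nonneg.2 hs.1),
        mul_nonneg (neg_nonneg.2 h0) (sub_nonneg.2 hs.2)]
  have hγd : ∀ s, HasDerivWithinAt γ (c, 1) (Icc t₀ t₁) s := fun s => by
    have h1 : HasDerivAt (fun s => x₀ + c * (s - t₀)) c s := by
      simpa using (((hasDerivAt_id s).sub_const t₀).const_mul c).const_add x₀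
    exact (h1.prodMk (hasDerivAt_id s)).hasDerivWithinAt
  have hsplit : ((c, 1) : ℝ × ℝ) = c • ((1, 0) : ℝ × ℝ) + (0, 1) := by simp
  have hcomp : ∀ {f : ℝ → ℝ → ℝ}, IsC1On X T f → ∀ s ∈ Icc t₀ t₁,
      HasDerivWithinAt (fun s => Function.uncurry f (γ s))
        (c * dSpace X f (γ s).1 (γ s).2 + dTime T f (γ s).1 (γ s).2) (Icc t₀ t₁) s := by
    intro f hf s hs
    obtain ⟨m1, m2⟩ := hmem hs
    have h1 := (hf.hasFDerivWithinAt m1 m2).comp_hasDerivWithinAt (f := γ) s (hγd s) hmem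
    rw [hsplit, map_add, map_smul, ← hf.dSpace_eq hX m1 m2, ← hf.dTime_eq hT m1 m2] at h1
    exact h1
  have hd : ∀ s ∈ Icc t₀ t₁, HasDerivWithinAt
      (fun s => Function.uncurry η (γ s) + c * Function.uncurry u (γ s)) 0 (Icc t₀ t₁) s := by
    intro s hs
    have h1 := (hcomp h.smooth_eta s hs).add ((hcomp h.smooth_u s hs).const_mul c)
    convert! h1 using 1
    have e1 := h.mass _ (hmem hs).1 _ (hmem hs).2
    have e2 := h.momentum _ (hmem hs).1 _ (hmem hs).2
    linear_combination -e1 - c * e2 - dSpace X u (γ s).1 (γ s).2 * hc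
  have hconst := constant_of_has_deriv_right_zero (fun s hs => (hd s hs).continuousWithinAt)
    (fun s hs => (hd s (Ico_subset_Icc_self hs)).mono_of_mem_nhdsWithin
      (Icc_mem_nhdsGE_of_mem hs)) t₁ ⟨ht, le_rfl⟩
  have e₁ : γ t₁ = (x₁, t₁) := by
    simp only [hγ, ← hx]
    simp
  have e₀ : γ t₀ = (x₀, t₀) := by simp [hγ]
  rw [e₁, e₀] at hconst
  exact hconst

/-- D'Alembert's formula. -/
theorem isSaintVenantSolution_dAlembert {T : ℝ} (hT : 0 < T) {ζ₀ v₀ : ℝ → ℝ}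
    (hζ : ContDiff ℝ 1 ζ₀) (hv : ContDiff ℝ 1 v₀) :
    IsSaintVenantSolution univ T ζ₀ v₀
      (fun x t => ((ζ₀ (x - t) + v₀ (x - t)) + (ζ₀ (x + t) - v₀ (x + t))) / 2)
      (fun x t => ((ζ₀ (x - t) + v₀ (x - t)) - (ζ₀ (x + t) - v₀ (x + t))) / 2) := by
  have dζ : ∀ y, HasDerivAt ζ₀ (deriv ζ₀ y) y := fun y =>
    (hζ.differentiable one_ne_zero y).hasDerivAt
  have dv : ∀ y, HasDerivAt v₀ (deriv v₀ y) y := fun y =>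
    (hv.differentiable one_ne_zero y).hasDerivAt
  have tm : ∀ {f : ℝ → ℝ} {f' : ℝ} (x t : ℝ), HasDerivAt f f' (x - t) →
      HasDerivAt (fun τ => f (x - τ)) (-f') t := fun x t h => by
    simpa [Function.comp_def] using HasDerivAt.comp t h ((hasDerivAt_id t).const_sub x)
  have tp : ∀ {f : ℝ → ℝ} {f' : ℝ} (x t : ℝ), HasDerivAt f f' (x + t) →
      HasDerivAt (fun τ => f (x + τ)) f' t := fun x t h => by
    simpa [Function.comp_def] using HasDerivAt.comp t h ((hasDerivAt_id t).const_add x)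
  have sm : ∀ {f : ℝ → ℝ} {f' : ℝ} (x t : ℝ), HasDerivAt f f' (x - t) →
      HasDerivAt (fun y => f (y - t)) f' x := fun x t h => by
    simpa [Function.comp_def] using HasDerivAt.comp x h ((hasDerivAt_id x).sub_const t)
  have sp : ∀ {f : ℝ → ℝ} {f' : ℝ} (x t : ℝ), HasDerivAt f f' (x + t) →
      HasDerivAt (fun y => f (y + t)) f' x := fun x t h => by
    simpa [Function.comp_def] using HasDerivAt.comp x h ((hasDerivAt_id x).add_const t)
  have T1 : ∀ x, ∀ t ∈ Icc 0 T, dTime T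
      (fun x t => ((ζ₀ (x - t) + v₀ (x - t)) + (ζ₀ (x + t) - v₀ (x + t))) / 2) x t =
      ((-deriv ζ₀ (x - t) + -deriv v₀ (x - t)) + (deriv ζ₀ (x + t) - deriv v₀ (x + t))) / 2 :=
    fun x t ht => ((((tm x t (dζ _)).add (tm x t (dv _))).add
      ((tp x t (dζ _)).sub (tp x t (dv _)))).div_const 2).hasDerivWithinAt.derivWithin
      (uniqueDiffOn_Icc hT t ht)
  have T2 : ∀ x, ∀ t ∈ Icc 0 T, dTime T
      (fun x t => ((ζ₀ (x - t) + v₀ (x - t)) - (ζ₀ (x + t) - v₀ (x + t))) / 2) x t =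
      ((-deriv ζ₀ (x - t) + -deriv v₀ (x - t)) - (deriv ζ₀ (x + t) - deriv v₀ (x + t))) / 2 :=
    fun x t ht => ((((tm x t (dζ _)).add (tm x t (dv _))).sub
      ((tp x t (dζ _)).sub (tp x t (dv _)))).div_const 2).hasDerivWithinAt.derivWithin
      (uniqueDiffOn_Icc hT t ht)
  have S1 : ∀ x t, dSpace univ
      (fun x t => ((ζ₀ (x - t) + v₀ (x - t)) + (ζ₀ (x + t) - v₀ (x + t))) / 2) x t =
      ((deriv ζ₀ (x - t) + deriv v₀ (x - t)) + (deriv ζ₀ (x + t) - deriv v₀ (x + t))) / 2 :=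
    fun x t => ((((sm x t (dζ _)).add (sm x t (dv _))).add
      ((sp x t (dζ _)).sub (sp x t (dv _)))).div_const 2).hasDerivWithinAt.derivWithin
      uniqueDiffWithinAt_univ
  have S2 : ∀ x t, dSpace univ
      (fun x t => ((ζ₀ (x - t) + v₀ (x - t)) - (ζ₀ (x + t) - v₀ (x + t))) / 2) x t =
      ((deriv ζ₀ (x - t) + deriv v₀ (x - t)) - (deriv ζ₀ (x + t) - deriv v₀ (x + t))) / 2 :=
    fun x t => ((((sm x t (dζ _)).add (sm x t (dv _))).sub
      ((sp x t (dζ _)).sub (sp x t (dv _)))).div_const 2).hasDerivWithinAt.derivWithin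
      uniqueDiffWithinAt_univ
  refine ⟨?_, ?_, fun x _ t ht => ?_, fun x _ t ht => ?_, fun x _ => ?_, fun x _ => ?_⟩
  · refine ContDiff.contDiffOn ?_
    simp only [Function.uncurry_def]
    fun_prop
  · refine ContDiff.contDiffOn ?_
    simp only [Function.uncurry_def]
    fun_prop
  · rw [T1 x t ht, S2]
    ring
  · rw [T2 x t ht, S1]
    ring
  · simp
  · simp

/-! ### The reflected wave of the hybrid problem. -/

theorem reflect_half_sub {μ : ℝ} {f g : ℝ → ℝ} (hf : Continuous f) (hg : Continuous g) (t : ℝ) :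
    reflect μ (fun s => (f s - g s) / 2) t = (reflect μ f t - reflect μ g t) / 2 := by
  have hK := continuous_besselKernel μ
  have hp : ∀ {f g : ℝ → ℝ}, Continuous f → Continuous g → ∀ t,
      primitive (fun s => (f s - g s) / 2) t = (primitive f t - primitive g t) / 2 := by
    intro f g hf hg t
    rw [primitive, intervalIntegral.integral_div, intervalIntegral.integral_sub
      (hf.intervalIntegrable _ _) (hg.intervalIntegrable _ _)]
    rfl
  have hV : volterra (besselKernel μ) (fun s => (f s - g s) / 2) = fun t =>
      (volterra (besselKernel μ) f t - volterra (besselKernel μ) g t) / 2 := by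
    ext t
    simp only [volterra]
    rw [← intervalIntegral.integral_sub (Continuous.intervalIntegrable (by fun_prop) _ _)
      (Continuous.intervalIntegrable (by fun_prop) _ _), ← intervalIntegral.integral_div]
    refine intervalIntegral.integral_congr fun s _ => ?_
    ring
  have cf : Continuous fun s => volterra (besselKernel μ) f s - f s :=
    (continuous_volterra hK hf).sub hf
  have cg : Continuous fun s => volterra (besselKernel μ) g s - g s :=
    (continuous_volterra hK hg).sub hg
  have e : (fun s => volterra (besselKernel μ) (fun s => (f s - g s) / 2) s - (f s - g s) / 2) =
      fun s => ((volterra (besselKernel μ) f s - f s) -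
        (volterra (besselKernel μ) g s - g s)) / 2 := by
    ext s
    rw [hV]
    ring
  have e2 := hp cf cg
  simp only [reflect]
  rw [e, hV, funext e2, hp (continuous_primitive cf) (continuous_primitive cg)]
  ring

/-- The reflected wave of the hybrid problem is the restriction of the solution on the whole line
whose datum is the filtered reflected datum. -/
theorem exists_isSaintVenantSolution_reflect (μ T : ℝ) (hμ : 0 < μ) (hT : 0 < T) (η₀ u₀ : ℝ → ℝ)
    (hη₀ : ContDiff ℝ 1 η₀) (hu₀ : ContDiff ℝ 1 u₀)
    (hη₀s : ∀ x, 0 ≤ x → η₀ x = 0) (hu₀s : ∀ x, 0 ≤ x → u₀ x = 0)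
    (ηm um ηp up ηc uc : ℝ → ℝ → ℝ)
    (hybrid : IsHybridSVBSolution μ T η₀ u₀ ηm um ηp up)
    (cauchy : IsSaintVenantSolution univ T η₀ u₀ ηc uc) :
    ∃ ζ v : ℝ → ℝ → ℝ,
      IsSaintVenantSolution univ T (reflect μ fun x => -η₀ (-x)) (reflect μ fun x => u₀ (-x)) ζ v ∧
      ∀ x ≤ 0, ∀ t ∈ Icc 0 T, ηm x t - ηc x t = ζ x t ∧ um x t - uc x t = v x t := by
  have hc1 : ContDiff ℝ 1 fun x => -η₀ (-x) := by fun_prop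
  have hc2 : ContDiff ℝ 1 fun x => u₀ (-x) := by fun_prop
  have z1 : ∀ t ≤ 0, -η₀ (-t) = 0 := fun t ht => by rw [hη₀s _ (neg_nonneg.2 ht), neg_zero]
  have z2 : ∀ t ≤ 0, u₀ (-t) = 0 := fun t ht => hu₀s _ (neg_nonneg.2 ht)
  refine ⟨_, _, isSaintVenantSolution_dAlembert hT (contDiff_reflect hμ hc1 z1)
    (contDiff_reflect hμ hc2 z2), ?_⟩
  have hm := hybrid.left
  have hXm : UniqueDiffOn ℝ (Iic (0 : ℝ)) := uniqueDiffOn_Iic 0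
  -- the invariants on the left
  have right_m : ∀ x ≤ 0, ∀ t ∈ Icc 0 T, ηm x t + um x t = η₀ (x - t) + u₀ (x - t) := by
    intro x hx t ht
    have hx' : x - t ∈ Iic (0 : ℝ) := by
      have := ht.1
      simp only [mem_Iic]
      linarith
    have h := hm.eq_along_characteristic hXm ordConnected_Iic hT (c := 1) (by norm_num) hx'
      (mem_Iic.2 hx) le_rfl ht.1 ht.2 (by ring)
    rw [hm.initial_eta _ hx', hm.initial_u _ hx'] at h
    linarith
  have right_c : ∀ x, ∀ t ∈ Icc 0 T, ηc x t + uc x t = η₀ (x - t) + u₀ (x - t) := by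
    intro x t ht
    have h := cauchy.eq_along_characteristic uniqueDiffOn_univ ordConnected_univ hT (c := 1)
      (by norm_num) (mem_univ (x - t)) (mem_univ x) le_rfl ht.1 ht.2 (by ring)
    rw [cauchy.initial_eta _ (mem_univ _), cauchy.initial_u _ (mem_univ _)] at h
    linarith
  have left_c : ∀ x, ∀ t ∈ Icc 0 T, ηc x t - uc x t = η₀ (x + t) - u₀ (x + t) := by
    intro x t ht
    have h := cauchy.eq_along_characteristic uniqueDiffOn_univ ordConnected_univ hT (c := -1)
      (by norm_num) (mem_univ (x + t)) (mem_univ x) le_rfl ht.1 ht.2 (by ring)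
    rw [cauchy.initial_eta _ (mem_univ _), cauchy.initial_u _ (mem_univ _)] at h
    linarith
  -- the trace at the interface
  let w : C(Icc (0 : ℝ) T, ℝ) := ⟨fun t => um 0 t, continuousOn_iff_continuous_domRestrict.1
    (continuousOn_slice hm.smooth_u.continuousOn self_mem_Iic)⟩
  have hw : ∀ t, w t = um 0 t := fun t => rfl
  have hB := hybrid.right.integral_dSpace_eq hμ hT hη₀s hu₀s
    (v := w) fun t => hybrid.coupling_u t t.2
  -- Mass conservation on the left gives η₋ = -J ∂ₓu₋ at x = 0; the coupling of ∂ₓu and the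
  -- half-line relation turn this into B u₋.
  have hη : ∀ t : Icc (0 : ℝ) T, ηm 0 t = besselOp μ hT.le w t := by
    intro t
    have h1 := hm.smooth_eta.integral_dTime hXm hT self_mem_Iic t.2
    rw [hm.initial_eta 0 self_mem_Iic, hη₀s 0 le_rfl, sub_zero] at h1
    rw [← h1, ← neg_neg (besselOp μ hT.le w t), ← hB, ← intervalIntegral.integral_neg]
    refine intervalIntegral.integral_congr fun s hs => ?_
    rw [uIcc_of_le t.2.1] at hs
    have hs' : s ∈ Icc 0 T := ⟨hs.1, hs.2.trans t.2.2⟩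
    have h2 := hm.mass 0 self_mem_Iic s hs'
    rw [hybrid.coupling_ux s hs'] at h2
    exact eq_neg_of_add_eq_zero_left h2
  -- Half of the invariant η₀ + u₀ carried to the interface, written with the components of G R W₀,
  -- so that η₋ + u₋ = 2a at x = 0.
  set a : ℝ → ℝ := fun t => (u₀ (-t) - -η₀ (-t)) / 2 with ha
  have hac : Continuous a := (hc2.continuous.sub hc1.continuous).div_const 2
  have hwa : ∀ t : Icc (0 : ℝ) T, w t = a t + reflect μ a t := by
    refine eq_add_reflect hμ hT.le hac w fun t => ?_
    have h1 := right_m 0 le_rfl t t.2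
    rw [← hη, hw]
    rw [zero_sub] at h1
    simp only [ha]
    linarith
  have ha2 : ∀ t, 2 * reflect μ a t =
      reflect μ (fun x => u₀ (-x)) t - reflect μ (fun x => -η₀ (-x)) t := by
    intro t
    rw [ha, reflect_half_sub hc2.continuous hc1.continuous]
    ring
  intro x hx t ht
  have e1 := right_m x hx t ht
  have e2 := right_c x t ht
  have e3 := left_c x t ht
  have r1 : reflect μ (fun x => -η₀ (-x)) (x - t) = 0 :=
    reflect_eq_zero z1 (by linarith [ht.1])
  have r2 : reflect μ (fun x => u₀ (-x)) (x - t) = 0 :=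
    reflect_eq_zero z2 (by linarith [ht.1])
  -- Only the left-going invariant is reflected. The characteristic through (x, t) is traced back to
  -- the initial line if x + t ≤ 0, where both sides vanish, and otherwise to the interface at time
  -- x + t, where η₋ - u₋ = 2a - 2u₋ = -2 R a.
  have e4 : (ηm x t - ηc x t) - (um x t - uc x t) =
      reflect μ (fun x => -η₀ (-x)) (x + t) - reflect μ (fun x => u₀ (-x)) (x + t) := by
    rcases le_or_gt (x + t) 0 with hxt | hxt
    · have h := hm.eq_along_characteristic hXm ordConnected_Iic hT (c := -1) (by norm_num)
        (mem_Iic.2 hxt) (mem_Iic.2 hx) le_rfl ht.1 ht.2 (by ring)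
      rw [hm.initial_eta _ hxt, hm.initial_u _ hxt] at h
      rw [reflect_eq_zero z1 hxt, reflect_eq_zero z2 hxt]
      linarith
    · have h := hm.eq_along_characteristic hXm ordConnected_Iic hT (c := -1) (by norm_num)
        (self_mem_Iic (a := (0 : ℝ))) (mem_Iic.2 hx) hxt.le (by linarith : x + t ≤ t) ht.2 (by ring)
      have hτ : x + t ∈ Icc 0 T := ⟨hxt.le, by linarith [ht.2]⟩
      have h1 := right_m 0 le_rfl (x + t) hτ
      have h2 := hwa ⟨x + t, hτ⟩
      rw [hw] at h2
      have h3 := ha2 (x + t)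
      rw [hη₀s _ hxt.le, hu₀s _ hxt.le] at e3
      rw [zero_sub] at h1
      simp only [ha] at h2
      simp only [ha] at h3
      linarith
  rw [r1, r2]
  constructor <;> linarith

end

theorem mainTheorem8 (μ T : ℝ) (hμ : 0 < μ) (hT : 0 < T) (η₀ u₀ : ℝ → ℝ)
    (hη₀ : ContDiff ℝ 1 η₀) (hu₀ : ContDiff ℝ 1 u₀)
    (hη₀L : MemLp η₀ 2 (volume : Measure ℝ)) (hu₀L : MemLp u₀ 2 (volume : Measure ℝ))
    (hη₀s : Function.support η₀ ⊆ Iio 0) (hu₀s : Function.support u₀ ⊆ Iio 0)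
    (ηm um ηp up ηc uc : ℝ → ℝ → ℝ)
    (hybrid : IsHybridSVBSolution μ T η₀ u₀ ηm um ηp up)
    (cauchy : IsSaintVenantSolution univ T η₀ u₀ ηc uc) :
    (∃ ρ : ℝ → ℂ,
      (∀ ω : ℝ, Tendsto (fun σ : ℝ => reflectionCoeff μ (σ + Complex.I * ω))
        (𝓝[>] 0) (𝓝 (ρ ω))) ∧
      (∀ ω ∈ Ioo (-(1 / μ)) (1 / μ), ρ ω = reflectionCoeff μ (Complex.I * ω)) ∧
      IsFilteredReflection (fun κ => ρ (dispersion 0 κ)) T η₀ u₀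
        (fun x t => ηm x t - ηc x t) (fun x t => um x t - uc x t)) ∧
    (HasSpectrumIn (1 / μ) η₀ → HasSpectrumIn (1 / μ) u₀ →
      IsFilteredReflection (fun κ => reflectionCoeff μ (Complex.I * dispersion 0 κ)) T η₀ u₀
        (fun x t => ηm x t - ηc x t) (fun x t => um x t - uc x t)) := by
  have hη0 : ∀ x, 0 ≤ x → η₀ x = 0 := fun x hx => by
    by_contra h
    exact (mem_Iio.1 (hη₀s h)).not_ge hx
  have hu0 : ∀ x, 0 ≤ x → u₀ x = 0 := fun x hx => by
    by_contra h
    exact (mem_Iio.1 (hu₀s h)).not_ge hx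
  choose ρ hρ hρ' using exists_tendsto_reflectionCoeff hμ
  obtain ⟨ζ, v, hζv, heq⟩ := exists_isSaintVenantSolution_reflect μ T hμ hT η₀ u₀ hη₀ hu₀ hη0 hu0
    ηm um ηp up ηc uc hybrid cauchy
  have hneg := Measure.measurePreserving_neg (volume : Measure ℝ)
  have hL1 : MemLp (fun x => -η₀ (-x)) 2 volume := (hη₀L.comp_measurePreserving hneg).neg
  have f1 : IsFilteredBy ρ (fun x => -η₀ (-x)) (reflect μ fun x => -η₀ (-x)) :=
    isFilteredBy_reflect (f := fun x => -η₀ (-x)) hμ (by fun_prop)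
      (fun t ht => by rw [hη0 _ (neg_nonneg.2 ht), neg_zero])
      hL1 hρ
  have f2 : IsFilteredBy ρ (fun x => u₀ (-x)) (reflect μ fun x => u₀ (-x)) :=
    isFilteredBy_reflect (f := fun x => u₀ (-x)) hμ (by fun_prop) (fun t ht => hu0 _ (neg_nonneg.2 ht))
      (hu₀L.comp_measurePreserving hneg) hρ
  simp only [dispersion_zero]
  exact ⟨⟨ρ, hρ, hρ', _, _, ζ, v, f1, f2, hζv, heq⟩, fun s1 s2 =>
    ⟨_, _, ζ, v, f1.congr_of_hasSpectrumIn s1 (Or.inr fun _ => rfl) hρ',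
      f2.congr_of_hasSpectrumIn s2 (Or.inl fun _ => rfl) hρ', hζv, heq⟩⟩
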